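/- Let $\mathcal N=\omega^\omega$ be Baire space (its elements are called reals), and let $\le_T$ and $\equiv_T$ denote Turing reducibility and Turing equivalence on $\mathcal N$. Sets of Turing degrees are identified with Turing closed sets of reals, i.e. sets $A\subseteq\mathcal N$ such that $x\in A$ and $x\equiv_T y$ imply $y\in A$. A set $A\subseteq\mathcal N$ is cofinal in the Turing degrees if for every $x\in\mathcal N$ there is $y\in A$ with $x\le_T y$. Write $x\le_h y$ if $x$ is hyperarithmetic in $y$, i.e. $x\in\Delta^1_1(y)$. The pointclasses $\Sigma^1_1$ and $\Delta^1_1$ are the lightface ones. For $A\subseteq\mathcal N$, in the game $G_\omega(A)$ players I and II alternately play natural numbers $x(0),x(1),x(2),\dots$, with I moving first, and I wins if and only if $x\in A$. Assume Turing determinacy for $\Delta^1_1$ sets: for every Turing closed $\Delta^1_1$ set $A\subseteq\mathcal N$, the game $G_\omega(A)$ is determined. **Theorem.** Let $(S_k)_{k<\omega}$ be a $\Sigma^1_1$ sequence of sets of Turing degrees, i.e. each $S_k\subseteq\mathcal N$ is Turing closed and the relation $\{(k,x): x\in S_k\}\subseteq\omega\times\mathcal N$ is $\Sigma^1_1$.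 Suppose that each $S_k$ is cofinal in the Turing degrees. Then $\bigcap_k S_k\neq\emptyset$ and, indeed, $\bigcap_k S_k$ contains a hyp-Turing cone: there is $d_0\in\mathcal N$ such that $$\{x\in\mathcal N : d_0\le_T x \ \text{ and }\ x\le_h d_0\}\subseteq\bigcap_k S_k .$$ -/

import Mathlib

/-- Baire space `ω^ω`; its elements are called reals. -/
abbrev Baire : Type := ℕ → ℕ

namespace Baire

/-- The finite initial segment `⟨x 0, …, x (t - 1)⟩`. -/
def initSeg (x : Baire) (t : ℕ) : List ℕ := (List.range t).map x

/-! ### Turing reducibility, Turing closed sets, cofinality -/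

/-- `x ≤_T y`: the total function `x` is recursive in the oracle `y`. -/
def TuringLE (x y : Baire) : Prop := TuringReducible (x : ℕ →. ℕ) (y : ℕ →. ℕ)

/-- `x ≡_T y`. -/
def TuringEq (x y : Baire) : Prop := TuringLE x y ∧ TuringLE y x

/-- Turing closed sets of reals. These correspond to the sets of Turing degrees. -/
def TuringClosed (A : Set Baire) : Prop := ∀ x y, TuringEq x y → x ∈ A → y ∈ A

/-- `A` is cofinal in the Turing degrees. -/
def TuringCofinal (A : Set Baire) : Prop := ∀ x, ∃ y ∈ A, TuringLE x y

/-! ### Lightface pointclasses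

Relations `P i x` with `i` in a discrete coded type `ι` (here `ℕ`, `ℕ × ℕ`, or the one-point
type `Unit`) and `x` in Baire space. -/

/-- Lightface `Π⁰₁` relations on `ι × ω^ω × ω^ω`. -/
def IsPi01 {ι : Type} [Primcodable ι] (Q : ι → Baire → Baire → Prop) : Prop :=
  ∃ R : ι × List ℕ × List ℕ → Prop, ComputablePred R ∧
    ∀ i x y, Q i x y ↔ ∀ t : ℕ, R (i, initSeg x t, initSeg y t)

/-- Lightface `Σ¹₁` relations on `ι × ω^ω`: projections along `ω^ω` of `Π⁰₁` relations. -/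
def IsSigma11 {ι : Type} [Primcodable ι] (P : ι → Baire → Prop) : Prop :=
  ∃ Q : ι → Baire → Baire → Prop, IsPi01 Q ∧ ∀ i x, P i x ↔ ∃ y, Q i x y

/-- Lightface `Π¹₁` relations on `ι × ω^ω`. -/
def IsPi11 {ι : Type} [Primcodable ι] (P : ι → Baire → Prop) : Prop :=
  IsSigma11 fun i x => ¬ P i x

/-- Lightface `Δ¹₁` sets of reals. -/
def IsDelta11Set (A : Set Baire) : Prop :=
  IsSigma11 (fun (_ : Unit) x => x ∈ A) ∧ IsPi11 (fun (_ : Unit) x => x ∈ A)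

/-- A `Σ¹₁` sequence of sets of reals: the relation `x ∈ S k` on `ω × ω^ω` is `Σ¹₁`. -/
def IsSigma11Seq (S : ℕ → Set Baire) : Prop :=
  IsSigma11 fun k x => x ∈ S k

/-- The relation `P` on `ι` is `Σ¹₁(y)`. -/
def IsSigma11In {ι : Type} [Primcodable ι] (y : Baire) (P : ι → Prop) : Prop :=
  ∃ Q : ι → Baire → Prop, IsSigma11 Q ∧ ∀ i, P i ↔ Q i y

/-- The relation `P` on `ι` is `Π¹₁(y)`. -/
def IsPi11In {ι : Type} [Primcodable ι] (y : Baire) (P : ι → Prop) : Prop :=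
  ∃ Q : ι → Baire → Prop, IsPi11 Q ∧ ∀ i, P i ↔ Q i y

/-- `x ≤_h y`: the graph of `x` is `Δ¹₁(y)`, i.e. both `Σ¹₁(y)` and `Π¹₁(y)`. -/
def HypLE (x y : Baire) : Prop :=
  IsSigma11In y (fun p : ℕ × ℕ => x p.1 = p.2) ∧ IsPi11In y (fun p : ℕ × ℕ => x p.1 = p.2)

/-- The hyp-Turing cone with vertex `d`, as a (Turing closed) set of reals. -/
def hypTuringCone (d : Baire) : Set Baire := {x | TuringLE d x ∧ HypLE x d}

/-! ### Infinite games

In the game `G_ω(A)` the players alternately choose natural numbers `x 0, x 1, x 2, …`, player I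
choosing those with even index; player I wins the play `x` if `x ∈ A`, otherwise player II wins.
A strategy assigns a move to each finite sequence of previous moves. -/

/-- In the play `x`, player I follows the strategy `σ`. -/
def FollowsI (σ : List ℕ → ℕ) (x : Baire) : Prop := ∀ n, x (2 * n) = σ (initSeg x (2 * n))

/-- In the play `x`, player II follows the strategy `τ`. -/
def FollowsII (τ : List ℕ → ℕ) (x : Baire) : Prop :=
  ∀ n, x (2 * n + 1) = τ (initSeg x (2 * n + 1))

/-- The game `G_ω(A)` is determined: one of the players has a winning strategy. -/
def Determined (A : Set Baire) : Prop :=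
  (∃ σ, ∀ x, FollowsI σ x → x ∈ A) ∨ (∃ τ, ∀ x, FollowsII τ x → x ∉ A)

/-- Turing determinacy for `Δ¹₁` sets. -/
def Delta11TuringDeterminacy : Prop :=
  ∀ A : Set Baire, IsDelta11Set A → TuringClosed A → Determined A

end Baire

/-!
If no hyp-Turing cone is contained in `⋂ k, S k`, then every real `d` has some `x` hyperarithmetic
in it with `d ≤_T x` and `x ∉ S k` for some `k`. As `d ⊕ x ≡_T x`, also `d ⊕ x ∉ S k`. The relation
"the machine index `c` codes at `d` a real `z` with `d ⊕ z ∉ S k`" between `d` and `(c, k)` is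
`Π¹₁`, provided that reals hyperarithmetic in `d` are coded through a `Π¹₁` relation that is
single-valued (`exists_hyp_coding`). Uniformizing it in the discrete variable `(c, k)` selects one
pair for every `d`, and a total function with discrete values and `Π¹₁` graph is `Δ¹₁`. So the set
of all `d ⊕ z` for which the selected number is `k` is `Σ¹₁` and disjoint from `S k`; for some
`k` it is cofinal, since a real above bounds for all the numbers `k` has to select one of them
(`exists_cofinal_disjoint`).

On the other hand, two disjoint `Σ¹₁` sets, one of them Turing closed, cannot both be cofinal
(`Delta11TuringDeterminacy.not_disjoint`). They are separated by a `Δ¹₁` set `C`; the set of reals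
all of whose Turing equivalents lie in `C` is again `Δ¹₁`, because the equivalents of a real are
enumerated by machine indices (`IsDelta11Set.turingCore`). It is Turing closed and separates the
two given sets, hence both it and its complement are cofinal, and its game is not determined:
against a real that computes the winning strategy, the play is Turing equivalent to that real.

Both steps rest on uniformization of `Π¹₁` relations in a discrete variable
(`IsPi11.exists_uniformization`), which also gives separation. A `Π¹₁` relation says that a tree of
finite sequences is well-founded, the comparison of ranks of such trees is `Σ¹₁` (it asks for a
level by level embedding), and one selects the least index among the trees of minimal rank.

Definability is handled with a small calculus of functionals `ι → ω^ω → α` that are primitive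
recursive with a primitive recursive modulus of continuity (`RecFun`), where pairs and sequences of
reals are coded by single reals. Turing reducibility enters through the use principle
(`exists_approximates`).
-/

namespace Baire

open Nat.Partrec (Code)

variable {ι κ α β : Type} [Primcodable ι] [Primcodable κ] [Primcodable α] [Primcodable β]

/-! ### Recursive functionals with a modulus of continuity -/

@[simp] theorem length_initSeg (x : Baire) (t : ℕ) : (initSeg x t).length = t := by
  simp [initSeg]

theorem take_initSeg (x : Baire) {s t : ℕ} (h : s ≤ t) :
    (initSeg x t).take s = initSeg x s := by
  simp [initSeg, ← List.map_take, List.take_range, h]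

theorem getD_initSeg (x : Baire) {n t : ℕ} (h : n < t) : (initSeg x t).getD n 0 = x n := by
  simp [initSeg, List.getD_eq_getElem?_getD, h]

theorem initSeg_succ (x : Baire) (t : ℕ) : initSeg x (t + 1) = initSeg x t ++ [x t] := by
  simp [initSeg, List.range_succ]

/-- A functional `h` of a discrete argument and a real is `RecFun` if it is primitive recursive and
the length of the initial segment of the real on which it depends is bounded by a primitive
recursive function of the discrete argument. -/
def RecFun (h : ι → Baire → α) : Prop :=
  ∃ (g : ι → ℕ) (H : ι × List ℕ → α), Primrec g ∧ Primrec H ∧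
    ∀ i w t, g i ≤ t → h i w = H (i, initSeg w t)

/-- A map from reals to reals, with a discrete parameter, is recursive if its values are given by a
`RecFun` functional. -/
def RecMap (F : ι → Baire → Baire) : Prop :=
  RecFun fun (p : ι × ℕ) w => F p.1 w p.2

namespace RecFun

theorem of_primrec {p : ι → α} (hp : Primrec p) : RecFun fun i (_ : Baire) => p i :=
  ⟨fun _ => 0, fun q => p q.1, Primrec.const 0, hp.comp Primrec.fst, fun _ _ _ _ => rfl⟩

theorem eval {u : ι → ℕ} (hu : Primrec u) : RecFun fun i w => w (u i) :=
  ⟨fun i => u i + 1, fun q => q.2.getD (u q.1) 0, Primrec.succ.comp hu,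
    (Primrec.list_getD 0).comp Primrec.snd (hu.comp Primrec.fst),
    fun _ _ _ h => (getD_initSeg _ h).symm⟩

theorem initSeg {u : ι → ℕ} (hu : Primrec u) : RecFun fun i w => initSeg w (u i) :=
  ⟨u, fun q => q.2.take (u q.1), hu,
    Primrec.list_take.comp (hu.comp Primrec.fst) Primrec.snd,
    fun _ _ _ h => (take_initSeg _ h).symm⟩

theorem pair {h : ι → Baire → α} {k : ι → Baire → β} (hh : RecFun h) (hk : RecFun k) :
    RecFun fun i w => (h i w, k i w) := by
  obtain ⟨g, H, hg, hH, e⟩ := hh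
  obtain ⟨g', K, hg', hK, e'⟩ := hk
  exact ⟨fun i => max (g i) (g' i), fun q => (H q, K q), Primrec.nat_max.comp hg hg',
    hH.pair hK, fun i w t ht => Prod.ext (e i w t (le_trans (le_max_left _ _) ht))
      (e' i w t (le_trans (le_max_right _ _) ht))⟩

theorem comp {p : α → β} (hp : Primrec p) {h : ι → Baire → α} (hh : RecFun h) :
    RecFun fun i w => p (h i w) := by
  obtain ⟨g, H, hg, hH, e⟩ := hh
  exact ⟨g, fun q => p (H q), hg, hp.comp hH, fun i w t ht => congrArg p (e i w t ht)⟩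

theorem comp₂ {p : ι → α → β} (hp : Primrec₂ p) {h : ι → Baire → α} (hh : RecFun h) :
    RecFun fun i w => p i (h i w) :=
  comp (p := fun q : ι × α => p q.1 q.2) hp ((of_primrec Primrec.id).pair hh)

theorem reindex {u : κ → ι} (hu : Primrec u) {h : ι → Baire → α} (hh : RecFun h) :
    RecFun fun k w => h (u k) w := by
  obtain ⟨g, H, hg, hH, e⟩ := hh
  exact ⟨fun k => g (u k), fun q => H (u q.1, q.2), hg.comp hu,
    hH.comp ((hu.comp Primrec.fst).pair Primrec.snd), fun k w t ht => e (u k) w t ht⟩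

/-- Finite lists of values. The modulus is the sum of the moduli of the entries. -/
theorem list {h : ι × ℕ → Baire → α} (hh : RecFun h) {u : ι → ℕ} (hu : Primrec u) :
    RecFun fun i w => (List.range (u i)).map fun j => h (i, j) w := by
  obtain ⟨g, H, hg, hH, e⟩ := hh
  refine ⟨fun i => ((List.range (u i)).map fun j => g (i, j)).foldr (fun a b => a + b) 0,
    fun q => (List.range (u q.1)).map fun j => H ((q.1, j), q.2), ?_, ?_, ?_⟩
  · refine Primrec.list_foldr (h := fun _ p => p.1 + p.2)
      (Primrec.list_map (Primrec.list_range.comp hu) hg) (Primrec.const 0) ?_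
    exact Primrec.nat_add.comp (Primrec.fst.comp Primrec.snd) (Primrec.snd.comp Primrec.snd)
  · refine Primrec.list_map (Primrec.list_range.comp (hu.comp Primrec.fst)) ?_
    exact hH.comp (((Primrec.fst.comp Primrec.fst).pair Primrec.snd).pair
      (Primrec.snd.comp Primrec.fst))
  · intro i w t ht
    refine List.map_congr_left fun j hj => e _ _ _ (le_trans ?_ ht)
    exact List.single_le_sum (fun _ _ => Nat.zero_le _) _ (List.mem_map_of_mem hj)

theorem subst {h : ι → Baire → α} (hh : RecFun h) {F : ι → Baire → Baire} (hF : RecMap F) :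
    RecFun fun i w => h i (F i w) := by
  obtain ⟨g, H, hg, hH, e⟩ := hh
  have := comp hH ((of_primrec Primrec.id).pair (list hF hg))
  convert this using 3 with i w
  exact e i _ _ le_rfl

theorem subst_reindex {h : κ → Baire → α} (hh : RecFun h) {u : ι → κ} (hu : Primrec u)
    {F : ι → Baire → Baire} (hF : RecMap F) : RecFun fun i w => h (u i) (F i w) :=
  (hh.reindex hu).subst hF

theorem initSeg_map {F : ι → Baire → Baire} (hF : RecMap F) {u : ι → ℕ} (hu : Primrec u) :
    RecFun fun i w => Baire.initSeg (F i w) (u i) := list hF hu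

theorem option_casesOn {p : ι → Option κ} (hp : Primrec p) {b : α}
    {h : ι × κ → Baire → α} (hh : RecFun h) :
    RecFun fun i w => (p i).elim b fun k => h (i, k) w := by
  obtain ⟨g, H, hg, hH, e⟩ := hh
  refine ⟨fun i => (p i).elim 0 fun k => g (i, k),
    fun q => (p q.1).elim b fun k => H ((q.1, k), q.2), ?_, ?_, ?_⟩
  · refine (Primrec.option_casesOn hp (Primrec.const 0) (g := fun i k => g (i, k)) hg).of_eq ?_
    intro i; cases p i <;> rfl
  · refine (Primrec.option_casesOn (hp.comp Primrec.fst) (Primrec.const b)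
      (g := fun q k => H ((q.1, k), q.2)) ?_).of_eq ?_
    · exact hH.comp (((Primrec.fst.comp Primrec.fst).pair Primrec.snd).pair
        (Primrec.snd.comp Primrec.fst))
    · intro q; cases p q.1 <;> rfl
  · intro i w t ht
    cases hpi : p i with
    | none => simp [hpi]
    | some k => simpa [hpi] using e (i, k) w t (by simpa [hpi] using ht)

end RecFun

/-! ### Coding of pairs and sequences of reals -/

/-- The join `x ⊕ y`. -/
def join (x y : Baire) : Baire := fun n => bif n.bodd then y n.div2 else x n.div2

/-- The even part of a real. -/
def left (w : Baire) : Baire := fun n => w (2 * n)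

/-- The odd part of a real. -/
def right (w : Baire) : Baire := fun n => w (2 * n + 1)

/-- The `k`-th column of a real coding a sequence of reals. -/
def column (w : Baire) (k : ℕ) : Baire := fun n => w (Nat.pair k n)

/-- The real without its first entry. -/
def tail (w : Baire) : Baire := fun n => w (n + 1)

@[simp] theorem left_join (x y : Baire) : left (join x y) = x := by
  funext n; simp [left, join]

@[simp] theorem right_join (x y : Baire) : right (join x y) = y := by
  funext n; simp [right, join]

@[simp] theorem join_left_right (w : Baire) : join (left w) (right w) = w := by
  funext n
  have := Nat.bodd_add_div2 n
  cases h : n.bodd <;> simp [h] at this <;> simp [left, right, join, h]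
  · rw [this]
  · rw [add_comm, this]

theorem exists_column (f : ℕ → Baire) : ∃ w, ∀ k, column w k = f k :=
  ⟨fun n => f n.unpair.1 n.unpair.2, fun k => by funext n; simp [column]⟩

theorem exists_tail (n : ℕ) (y : Baire) : ∃ w : Baire, w 0 = n ∧ tail w = y :=
  ⟨fun m => Nat.casesOn m n y, rfl, rfl⟩

namespace RecMap

theorem id : RecMap fun (_ : ι) w => w := RecFun.eval Primrec.snd

theorem left {F : ι → Baire → Baire} (hF : RecMap F) : RecMap fun i w => left (F i w) :=
  hF.reindex (u := fun p : ι × ℕ => (p.1, 2 * p.2))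
    (Primrec.fst.pair (Primrec.nat_double.comp Primrec.snd))

theorem right {F : ι → Baire → Baire} (hF : RecMap F) : RecMap fun i w => right (F i w) :=
  hF.reindex (u := fun p : ι × ℕ => (p.1, 2 * p.2 + 1))
    (Primrec.fst.pair (Primrec.nat_double_succ.comp Primrec.snd))

theorem tail {F : ι → Baire → Baire} (hF : RecMap F) : RecMap fun i w => tail (F i w) :=
  hF.reindex (u := fun p : ι × ℕ => (p.1, p.2 + 1))
    (Primrec.fst.pair (Primrec.succ.comp Primrec.snd))

theorem column {F : ι → Baire → Baire} (hF : RecMap F) {u : ι → ℕ} (hu : Primrec u) :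
    RecMap fun i w => column (F i w) (u i) :=
  hF.reindex (u := fun p : ι × ℕ => (p.1, Nat.pair (u p.1) p.2))
    (Primrec.fst.pair (Primrec₂.natPair.comp (hu.comp Primrec.fst) Primrec.snd))

theorem join {F G : ι → Baire → Baire} (hF : RecMap F) (hG : RecMap G) :
    RecMap fun i w => join (F i w) (G i w) := by
  have hd : Primrec fun p : ι × ℕ => (p.1, p.2.div2) :=
    Primrec.fst.pair (Primrec.nat_div2.comp Primrec.snd)
  have := ((RecFun.reindex hd hF).pair (RecFun.reindex hd hG))
  refine RecFun.comp₂ (p := fun (i : ι × ℕ) (a : ℕ × ℕ) => bif i.2.bodd then a.2 else a.1)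
    ?_ this
  exact Primrec.cond (Primrec.nat_bodd.comp (Primrec.snd.comp Primrec.fst))
    (Primrec.snd.comp Primrec.snd) (Primrec.fst.comp Primrec.snd)

theorem reindex {F : ι → Baire → Baire} (hF : RecMap F) {u : κ → ι} (hu : Primrec u) :
    RecMap fun k w => F (u k) w :=
  RecFun.reindex (u := fun p : κ × ℕ => (u p.1, p.2))
    ((hu.comp Primrec.fst).pair Primrec.snd) hF

end RecMap

theorem RecFun.eval_map {F : ι → Baire → Baire} (hF : RecMap F) {u : ι → ℕ} (hu : Primrec u) :
    RecFun fun i w => F i w (u i) :=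
  RecFun.reindex (Primrec.id.pair hu) hF

/-! ### Lightface closed sets and the normal form of `Σ¹₁` relations -/

/-- Lightface `Π⁰₁` relations with one real argument, presented by a `RecFun` matrix. -/
def RecClosed (Q : ι → Baire → Prop) : Prop :=
  ∃ r : ι × ℕ → Baire → Bool, RecFun r ∧ ∀ i w, Q i w ↔ ∀ t, r (i, t) w = true

namespace RecClosed

theorem congr {Q Q' : ι → Baire → Prop} (h : RecClosed Q) (e : ∀ i w, Q' i w ↔ Q i w) :
    RecClosed Q' := by
  obtain ⟨r, hr, h⟩ := h
  exact ⟨r, hr, fun i w => (e i w).trans (h i w)⟩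

theorem of_recFun {b : ι → Baire → Bool} (hb : RecFun b) : RecClosed fun i w => b i w = true :=
  ⟨fun p w => b p.1 w, hb.reindex Primrec.fst, fun _ _ => by simp⟩

theorem subst {Q : κ → Baire → Prop} (hQ : RecClosed Q) {u : ι → κ} (hu : Primrec u)
    {F : ι → Baire → Baire} (hF : RecMap F) : RecClosed fun i w => Q (u i) (F i w) := by
  obtain ⟨r, hr, h⟩ := hQ
  refine ⟨fun p w => r (u p.1, p.2) (F p.1 w), ?_, fun i w => h _ _⟩
  exact hr.subst_reindex (u := fun p : ι × ℕ => (u p.1, p.2))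
    ((hu.comp Primrec.fst).pair Primrec.snd) (hF.reindex Primrec.fst)

theorem all {Q : ι × κ → Baire → Prop} (hQ : RecClosed Q) :
    RecClosed fun i w => ∀ k, Q (i, k) w := by
  obtain ⟨r, hr, h⟩ := hQ
  refine ⟨fun p w => (Encodable.decode (α := κ × ℕ) p.2).elim true
    fun q => r ((p.1, q.1), q.2) w, ?_, fun i w => ?_⟩
  · refine RecFun.option_casesOn (Primrec.decode.comp Primrec.snd)
      (h := fun p : (ι × ℕ) × (κ × ℕ) => r ((p.1.1, p.2.1), p.2.2)) ?_
    exact hr.reindex (u := fun p : (ι × ℕ) × (κ × ℕ) => ((p.1.1, p.2.1), p.2.2))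
      (((Primrec.fst.comp Primrec.fst).pair (Primrec.fst.comp Primrec.snd)).pair
        (Primrec.snd.comp Primrec.snd))
  · simp only [h]
    constructor
    · intro H t
      cases Encodable.decode (α := κ × ℕ) t with
      | none => rfl
      | some q => exact H q.1 q.2
    · intro H k t
      simpa using H (Encodable.encode (k, t))

theorem and {Q Q' : ι → Baire → Prop} (hQ : RecClosed Q) (hQ' : RecClosed Q') :
    RecClosed fun i w => Q i w ∧ Q' i w := by
  obtain ⟨r, hr, h⟩ := hQ
  obtain ⟨r', hr', h'⟩ := hQ'
  refine ⟨fun p w => r p w && r' p w, ?_, fun i w => ?_⟩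
  · exact RecFun.comp (p := fun b : Bool × Bool => b.1 && b.2) (Primrec.dom_finite _)
      (hr.pair hr')
  · simp [h, h', forall_and]

theorem or_recFun {Q : ι → Baire → Prop} (hQ : RecClosed Q) {b : ι → Baire → Bool}
    (hb : RecFun b) : RecClosed fun i w => b i w = true ∨ Q i w := by
  obtain ⟨r, hr, h⟩ := hQ
  refine ⟨fun p w => b p.1 w || r p w, ?_, fun i w => ?_⟩
  · exact RecFun.comp (p := fun b : Bool × Bool => b.1 || b.2) (Primrec.dom_finite _)
      ((hb.reindex Primrec.fst).pair hr)
  · simp [h, forall_or_left]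

end RecClosed

/-- The universal lightface closed relation: `c` is an index of a machine deciding a relation on
finite sequences, and `w` codes a pair of reals no initial segments of which are rejected. -/
def UnivClosed (p : Code × ι) (w : Baire) : Prop :=
  ∀ s t : ℕ, Code.evaln s p.1 (Encodable.encode (p.2, initSeg (left w) t, initSeg (right w) t)) ≠
    some (Encodable.encode false)

theorem recClosed_univClosed : RecClosed (UnivClosed : Code × ι → Baire → Prop) := by
  have key : RecFun fun (p : ((Code × ι) × ℕ) × ℕ) w =>
      !decide (Code.evaln p.1.2 p.1.1.1 (Encodable.encode
        (p.1.1.2, initSeg (left w) p.2, initSeg (right w) p.2)) =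
          some (Encodable.encode false)) := by
    have h1 : RecFun fun (p : ((Code × ι) × ℕ) × ℕ) w =>
        (initSeg (left w) p.2, initSeg (right w) p.2) :=
      (RecFun.initSeg_map RecMap.id.left Primrec.snd).pair
        (RecFun.initSeg_map RecMap.id.right Primrec.snd)
    refine RecFun.comp₂ (p := fun (p : ((Code × ι) × ℕ) × ℕ) (a : List ℕ × List ℕ) =>
      !decide (Code.evaln p.1.2 p.1.1.1 (Encodable.encode (p.1.1.2, a)) =
          some (Encodable.encode false))) ?_ h1
    refine Primrec.not.comp ?_
    refine primrecPred_iff_primrec_decide.1 (Primrec.eq.comp ?_ (Primrec.const _))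
    refine Code.primrec_evaln.comp (Primrec.pair (Primrec.pair ?_ ?_) (Primrec.encode.comp
      (Primrec.pair ?_ Primrec.snd)))
    · exact Primrec.snd.comp (Primrec.fst.comp Primrec.fst)
    · exact Primrec.fst.comp (Primrec.fst.comp (Primrec.fst.comp Primrec.fst))
    · exact Primrec.snd.comp (Primrec.fst.comp (Primrec.fst.comp Primrec.fst))
  refine (RecClosed.all (RecClosed.all (RecClosed.of_recFun key))).congr fun p w => ?_
  simp only [UnivClosed, ne_eq, Bool.not_eq_true', decide_eq_false_iff_not]

theorem exists_univClosed_index {Q : ι → Baire → Baire → Prop} (hQ : IsPi01 Q) :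
    ∃ c : Code, ∀ i x y, Q i x y ↔ UnivClosed (c, i) (join x y) := by
  obtain ⟨R, ⟨hd, hR⟩, h⟩ := hQ
  obtain ⟨c, hc⟩ := Code.exists_code.1 hR
  have hc' : ∀ a, Code.eval c (Encodable.encode a) =
      Part.some (Encodable.encode (decide (R a))) := by
    intro a; rw [hc]; simp
  refine ⟨c, fun i x y => ?_⟩
  rw [h]
  simp only [UnivClosed, left_join, right_join]
  constructor
  · intro H s t e
    have := Code.evaln_sound (Option.mem_def.2 e)
    rw [hc', Part.mem_some_iff, decide_eq_true (H t)] at this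
    exact absurd (Encodable.encode_injective this) (by simp)
  · intro H t
    by_contra hn
    have : Encodable.encode false ∈ Code.eval c
        (Encodable.encode (i, initSeg x t, initSeg y t)) := by
      rw [hc', decide_eq_false hn]; exact Part.mem_some _
    obtain ⟨s, hs⟩ := Code.evaln_complete.1 this
    exact H s t hs

/-- Every lightface closed relation has a matrix that is a primitive recursive function of the
initial segments of the two reals; the stage `t` codes a pair of a stage of the original matrix and
the length of initial segment this stage depends on. -/
theorem RecClosed.exists_primrec {Q : ι → Baire → Prop} (hQ : RecClosed Q) :
    ∃ R : ι × List ℕ × List ℕ → Bool, Primrec R ∧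
      ∀ i x y, Q i (join x y) ↔ ∀ t, R (i, initSeg x t, initSeg y t) = true := by
  obtain ⟨r, ⟨g, H, hg, hH, e⟩, h⟩ := hQ
  let J : List ℕ × List ℕ → List ℕ := fun l =>
    (List.range l.1.length).map fun n => bif n.bodd then l.2.getD n.div2 0 else l.1.getD n.div2 0
  have hJ : Primrec J := by
    refine Primrec.list_map (Primrec.list_range.comp (Primrec.list_length.comp Primrec.fst)) ?_
    refine Primrec.cond (Primrec.nat_bodd.comp Primrec.snd) ?_ ?_
    · exact (Primrec.list_getD 0).comp (Primrec.snd.comp Primrec.fst)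
        (Primrec.nat_div2.comp Primrec.snd)
    · exact (Primrec.list_getD 0).comp (Primrec.fst.comp Primrec.fst)
        (Primrec.nat_div2.comp Primrec.snd)
  have eJ : ∀ x y t, J (initSeg x t, initSeg y t) = initSeg (join x y) t := by
    intro x y t
    simp only [J, length_initSeg]
    refine List.map_congr_left fun n hn => ?_
    have hn' : n.div2 < t := lt_of_le_of_lt (by rw [Nat.div2_val]; omega) (List.mem_range.1 hn)
    simp only [join, getD_initSeg _ hn']
  refine ⟨fun p => !decide (g (p.1, p.2.1.length.unpair.1) ≤ p.2.1.length) ||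
    H ((p.1, p.2.1.length.unpair.1), J p.2), ?_, fun i x y => ?_⟩
  · have hi : Primrec fun p : ι × List ℕ × List ℕ => (p.1, p.2.1.length.unpair.1) :=
      Primrec.fst.pair (Primrec.fst.comp (Primrec.unpair.comp
        (Primrec.list_length.comp (Primrec.fst.comp Primrec.snd))))
    refine Primrec.or.comp (Primrec.not.comp (primrecPred_iff_primrec_decide.1
      (Primrec.nat_le.comp (hg.comp hi)
        (Primrec.list_length.comp (Primrec.fst.comp Primrec.snd))))) ?_
    exact hH.comp (hi.pair (hJ.comp Primrec.snd))
  · simp only [length_initSeg, eJ, h]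
    constructor
    · intro A t
      by_cases ht : g (i, t.unpair.1) ≤ t
      · rw [← e _ _ _ ht, A]; simp
      · simp [ht]
    · intro A t
      have := A (Nat.pair t (g (i, t)))
      have hle := Nat.right_le_pair t (g (i, t))
      simp only [Nat.unpair_pair, hle, decide_true, Bool.not_true, Bool.false_or] at this
      rw [e _ _ _ hle, this]

theorem isSigma11_iff {P : ι → Baire → Prop} :
    IsSigma11 P ↔ ∃ Q : ι → Baire → Prop, RecClosed Q ∧ ∀ i x, P i x ↔ ∃ y, Q i (join x y) := by
  constructor
  · rintro ⟨Q, hQ, h⟩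
    obtain ⟨c, hc⟩ := exists_univClosed_index hQ
    refine ⟨fun i w => UnivClosed (c, i) w, ?_, fun i x => by simp [h, hc]⟩
    exact recClosed_univClosed.subst ((Primrec.const c).pair Primrec.id) RecMap.id
  · rintro ⟨Q, hQ, h⟩
    obtain ⟨R, hR, e⟩ := hQ.exists_primrec
    refine ⟨fun i x y => Q i (join x y), ⟨fun p => R p = true, ?_, e⟩, h⟩
    exact ⟨inferInstance, by simpa using hR.to_comp⟩

/-- The normal form of `Σ¹₁` relations, with a primitive recursive matrix. -/
theorem IsSigma11.exists_primrec {P : ι → Baire → Prop} (hP : IsSigma11 P) :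
    ∃ R : ι × List ℕ × List ℕ → Bool, Primrec R ∧
      ∀ i x, P i x ↔ ∃ y, ∀ t, R (i, initSeg x t, initSeg y t) = true := by
  obtain ⟨Q, hQ, h⟩ := isSigma11_iff.1 hP
  obtain ⟨R, hR, e⟩ := hQ.exists_primrec
  exact ⟨R, hR, fun i x => by simp [h, e]⟩

/-- The universal `Σ¹₁` relation. -/
def UnivSigma (p : Code × ι) (x : Baire) : Prop := ∃ y, UnivClosed p (join x y)

theorem isSigma11_univSigma : IsSigma11 (UnivSigma : Code × ι → Baire → Prop) :=
  isSigma11_iff.2 ⟨_, recClosed_univClosed, fun _ _ => Iff.rfl⟩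

theorem exists_univSigma_index {P : ι → Baire → Prop} (hP : IsSigma11 P) :
    ∃ c : Code, ∀ i x, P i x ↔ UnivSigma (c, i) x := by
  obtain ⟨Q, hQ, h⟩ := hP
  obtain ⟨c, hc⟩ := exists_univClosed_index hQ
  exact ⟨c, fun i x => by simp [h, hc, UnivSigma]⟩

/-! ### Closure properties of `Σ¹₁` -/

namespace IsSigma11

theorem congr {P P' : ι → Baire → Prop} (h : IsSigma11 P) (e : ∀ i w, P' i w ↔ P i w) :
    IsSigma11 P' := by
  obtain ⟨r, hr, h⟩ := h
  exact ⟨r, hr, fun i w => (e i w).trans (h i w)⟩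

theorem of_recClosed {P : ι → Baire → Prop} (h : RecClosed P) : IsSigma11 P :=
  isSigma11_iff.2 ⟨_, h.subst Primrec.id RecMap.id.left, fun i x => by simp⟩

theorem of_recFun {b : ι → Baire → Bool} (hb : RecFun b) : IsSigma11 fun i w => b i w = true :=
  of_recClosed (.of_recFun hb)

theorem subst {P : κ → Baire → Prop} (hP : IsSigma11 P) {u : ι → κ} (hu : Primrec u)
    {F : ι → Baire → Baire} (hF : RecMap F) : IsSigma11 fun i w => P (u i) (F i w) := by
  obtain ⟨Q, hQ, h⟩ := isSigma11_iff.1 hP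
  have hF' : RecMap fun i w => F i (left w) := RecFun.subst hF RecMap.id.left
  exact isSigma11_iff.2 ⟨_, hQ.subst hu (hF'.join RecMap.id.right), fun i x => by simp [h]⟩

theorem reindex {P : κ → Baire → Prop} (hP : IsSigma11 P) {u : ι → κ} (hu : Primrec u) :
    IsSigma11 fun i w => P (u i) w := hP.subst hu RecMap.id

theorem exists_real {P : ι → Baire → Prop} (hP : IsSigma11 P) :
    IsSigma11 fun i x => ∃ y, P i (join x y) := by
  obtain ⟨Q, hQ, h⟩ := isSigma11_iff.1 hP
  refine isSigma11_iff.2 ⟨_, hQ.subst Primrec.id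
    ((RecMap.id.left.join RecMap.id.right.left).join RecMap.id.right.right), fun i x => ?_⟩
  simp only [h, left_join, right_join]
  exact ⟨fun ⟨y, z, H⟩ => ⟨join y z, by simpa using H⟩, fun ⟨y, H⟩ => ⟨_, _, H⟩⟩

theorem all {P : ι × κ → Baire → Prop} (hP : IsSigma11 P) :
    IsSigma11 fun i x => ∀ k, P (i, k) x := by
  obtain ⟨Q, hQ, h⟩ := isSigma11_iff.1 hP
  have hF : RecMap fun (p : ι × κ) w => join (left w) (column (right w) (Encodable.encode p.2)) :=
    RecMap.id.left.join (RecMap.id.right.column (Primrec.encode.comp Primrec.snd))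
  refine isSigma11_iff.2 ⟨_, (hQ.subst Primrec.id hF).all, fun i x => ?_⟩
  simp only [h, left_join, right_join, id]
  constructor
  · intro H
    choose f hf using H
    obtain ⟨w, hw⟩ := exists_column fun n =>
      (Encodable.decode (α := κ) n).elim (fun _ => 0) f
    exact ⟨w, fun k => by simpa [hw] using hf k⟩
  · exact fun ⟨y, H⟩ k => ⟨_, H k⟩

theorem ex {P : ι × κ → Baire → Prop} (hP : IsSigma11 P) :
    IsSigma11 fun i x => ∃ k, P (i, k) x := by
  obtain ⟨Q, hQ, h⟩ := isSigma11_iff.1 hP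
  have hb0 : RecFun fun (_ : ι × κ) w => right w 0 :=
    RecFun.eval_map RecMap.id.right (Primrec.const 0)
  have hb : RecFun fun (p : ι × κ) w => !decide (Encodable.encode
      (Encodable.decode (α := κ) (right w 0)) = Encodable.encode (some p.2)) := by
    refine RecFun.comp₂ (p := fun (p : ι × κ) a => !decide (Encodable.encode
      (Encodable.decode (α := κ) a) = Encodable.encode (some p.2))) ?_ hb0
    exact Primrec.not.comp (primrecPred_iff_primrec_decide.1
      (Primrec.eq.comp (Primrec.encdec.comp Primrec.snd)
        (Primrec.encode.comp (Primrec.option_some.comp (Primrec.snd.comp Primrec.fst)))))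
  -- The first entry of the witness codes `k`; the second conjunct says that it is a code at all.
  have hc : RecFun fun (_ : ι) w => (Encodable.decode (α := κ) (right w 0)).isSome :=
    RecFun.comp (Primrec.option_isSome.comp Primrec.decode)
      (RecFun.eval_map RecMap.id.right (Primrec.const 0))
  refine isSigma11_iff.2 ⟨_, ((hQ.subst Primrec.id
    (RecMap.id.left.join RecMap.id.right.tail)).or_recFun hb).all.and
      (RecClosed.of_recFun hc), fun i x => ?_⟩
  simp only [h, left_join, right_join, id]
  constructor
  · rintro ⟨k, y, H⟩
    obtain ⟨w, h0, hw⟩ := exists_tail (Encodable.encode k) y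
    refine ⟨w, fun k' => ?_, by simp [h0]⟩
    by_cases hk : k = k'
    · subst hk; exact Or.inr (by rwa [hw])
    · left; simpa [h0] using fun e => hk (Encodable.encode_injective e)
  · rintro ⟨w, H, hk⟩
    obtain ⟨k, hk⟩ := Option.isSome_iff_exists.1 hk
    exact ⟨k, _, (H k).resolve_left (by simp [hk])⟩

theorem or {P P' : ι → Baire → Prop} (hP : IsSigma11 P) (hP' : IsSigma11 P') :
    IsSigma11 fun i x => P i x ∨ P' i x := by
  obtain ⟨Q, hQ, h⟩ := isSigma11_iff.1 hP
  obtain ⟨Q', hQ', h'⟩ := isSigma11_iff.1 hP'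
  have hb0 : RecFun fun (_ : ι) w => right w 0 :=
    RecFun.eval_map RecMap.id.right (Primrec.const 0)
  have hb : RecFun fun (_ : ι) w => decide (right w 0 = 0) :=
    RecFun.comp (p := fun a => decide (a = 0)) (primrecPred_iff_primrec_decide.1
      (Primrec.eq.comp Primrec.id (Primrec.const 0))) hb0
  have hF : RecMap fun (_ : ι) w => join (left w) (tail (right w)) :=
    RecMap.id.left.join RecMap.id.right.tail
  refine isSigma11_iff.2 ⟨_, ((hQ.subst Primrec.id hF).or_recFun hb).and
    ((hQ'.subst Primrec.id hF).or_recFun (RecFun.comp Primrec.not hb)), fun i x => ?_⟩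
  simp only [h, h', left_join, right_join, id]
  constructor
  · rintro (⟨y, H⟩ | ⟨y, H⟩)
    · obtain ⟨w, h0, hw⟩ := exists_tail 1 y
      exact ⟨w, Or.inr (by rwa [hw]), Or.inl (by simp [h0])⟩
    · obtain ⟨w, h0, hw⟩ := exists_tail 0 y
      exact ⟨w, Or.inl (by simp [h0]), Or.inr (by rwa [hw])⟩
  · rintro ⟨w, H, H'⟩
    by_cases h0 : w 0 = 0
    · exact Or.inr ⟨_, H'.resolve_left (by simp [h0])⟩
    · exact Or.inl ⟨_, H.resolve_left (by simp [h0])⟩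

theorem and {P P' : ι → Baire → Prop} (hP : IsSigma11 P) (hP' : IsSigma11 P') :
    IsSigma11 fun i x => P i x ∧ P' i x := by
  obtain ⟨Q, hQ, h⟩ := isSigma11_iff.1 hP
  obtain ⟨Q', hQ', h'⟩ := isSigma11_iff.1 hP'
  refine isSigma11_iff.2 ⟨_, (hQ.subst Primrec.id
    (RecMap.id.left.join RecMap.id.right.left)).and (hQ'.subst Primrec.id
    (RecMap.id.left.join RecMap.id.right.right)), fun i x => ?_⟩
  simp only [h, h', left_join, right_join, id]
  exact ⟨fun ⟨⟨y, H⟩, ⟨z, H'⟩⟩ => ⟨join y z, by simpa using H, by simpa using H'⟩,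
    fun ⟨w, H, H'⟩ => ⟨⟨_, H⟩, ⟨_, H'⟩⟩⟩

end IsSigma11

/-! ### Comparison of well-founded trees -/

/-- In the set `T` of finite sequences, thought of as a tree, `t` is an immediate extension
of `s`. -/
def Child (T : Set (List ℕ)) (t s : List ℕ) : Prop := t ∈ T ∧ t ≠ [] ∧ t.dropLast = s

/-- `T` is a tree: it contains the empty sequence and is closed under initial segments. -/
def IsTree (T : Set (List ℕ)) : Prop := [] ∈ T ∧ ∀ s t : List ℕ, s <+: t → t ∈ T → s ∈ T

/-- The tree `T` is embedded in `T'` level by level, which for well-founded trees means that the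
rank of `T` is at most that of `T'`. -/
def TreeLE (T T' : Set (List ℕ)) : Prop :=
  ∃ F : List ℕ → List ℕ, F [] = [] ∧ ∀ t s, Child T t s → Child T' (F t) (F s)

/-- The tree `T` is embedded below some immediate successor of the root of `T'`, which for
well-founded trees means that the rank of `T` is less than that of `T'`. -/
def TreeLT (T T' : Set (List ℕ)) : Prop :=
  ∃ F : List ℕ → List ℕ, Child T' (F []) [] ∧ ∀ t s, Child T t s → Child T' (F t) (F s)

theorem wellFounded_child_iff {T : Set (List ℕ)} (hT : IsTree T) :
    WellFounded (Child T) ↔ ¬ ∃ y, ∀ t, initSeg y t ∈ T := by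
  rw [wellFounded_iff_isEmpty_descending_chain, ← not_nonempty_iff, not_iff_not]
  constructor
  · rintro ⟨f, hf⟩
    have hpre : ∀ n, f n <+: f (n + 1) := fun n => (hf n).2.2 ▸ List.dropLast_prefix _
    have hpre' : ∀ m n, m ≤ n → f m <+: f n := fun m n h =>
      Nat.le_induction (List.prefix_rfl) (fun k _ ih => ih.trans (hpre k)) n h
    have hlen : ∀ n, n ≤ (f n).length := by
      intro n
      induction n with
      | zero => exact Nat.zero_le _
      | succ n ih =>
        have h1 := congrArg List.length (hf n).2.2
        have h2 := List.length_pos_iff.2 (hf n).2.1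
        rw [List.length_dropLast] at h1
        omega
    refine ⟨fun j => (f (j + 1)).getD j 0, fun t => ?_⟩
    refine hT.2 _ (f (t + 1)) ?_ (hf t).1
    have : initSeg (fun j => (f (j + 1)).getD j 0) t = (f (t + 1)).take t := by
      refine List.ext_getElem (by simp [le_trans (Nat.le_succ t) (hlen (t + 1))]) ?_
      intro j h1 h2
      have hj : j < t := by simpa using h1
      have h3 : j < (f (j + 1)).length := hlen (j + 1)
      simp only [initSeg, List.getElem_map, List.getElem_range, List.getElem_take]
      rw [List.getD_eq_getElem _ _ h3]
      exact (hpre' (j + 1) (t + 1) (by omega)).getElem h3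
    rw [this]
    exact List.take_prefix _ _
  · rintro ⟨y, hy⟩
    refine ⟨fun n => initSeg y n, fun n => ⟨hy _, ?_, ?_⟩⟩ <;> simp [initSeg_succ]

/-- The rank of a node of a well-founded tree. -/
noncomputable def nodeRank {T : Set (List ℕ)} (h : WellFounded (Child T)) (s : List ℕ) :
    Ordinal.{0} := (h.apply s).rank

theorem nodeRank_lt {T : Set (List ℕ)} (h : WellFounded (Child T)) {t s : List ℕ}
    (hts : Child T t s) : nodeRank h t < nodeRank h s :=
  Acc.rank_lt_of_rel _ hts

theorem nodeRank_le_iff {T : Set (List ℕ)} (h : WellFounded (Child T)) {s : List ℕ}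
    {o : Ordinal.{0}} : nodeRank h s ≤ o ↔ ∀ t, Child T t s → nodeRank h t < o := by
  rw [nodeRank, Acc.rank_eq, Ordinal.iSup_le_iff]
  simp [nodeRank]

theorem exists_child_of_lt {T : Set (List ℕ)} (h : WellFounded (Child T)) {s : List ℕ}
    {o : Ordinal.{0}} (ho : o < nodeRank h s) : ∃ t, Child T t s ∧ o ≤ nodeRank h t := by
  by_contra hn
  push Not at hn
  exact absurd ((nodeRank_le_iff h).2 hn) (not_le.2 ho)

section Compare

variable {T T' : Set (List ℕ)}

theorem wellFounded_of_hom {F : List ℕ → List ℕ}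
    (hF : ∀ t s, Child T t s → Child T' (F t) (F s)) (h' : WellFounded (Child T')) :
    WellFounded (Child T) :=
  Subrelation.wf (fun {t s} => hF t s) (InvImage.wf F h')

theorem nodeRank_le_of_hom {F : List ℕ → List ℕ}
    (hF : ∀ t s, Child T t s → Child T' (F t) (F s)) (h : WellFounded (Child T))
    (h' : WellFounded (Child T')) (s : List ℕ) : nodeRank h s ≤ nodeRank h' (F s) := by
  induction s using h.induction with
  | _ s ih =>
    exact (nodeRank_le_iff h).2 fun t ht => (ih t ht).trans_lt (nodeRank_lt h' (hF t s ht))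

/-- A level by level map is built along the tree, keeping the rank of the image at least the rank
of the argument. -/
theorem exists_hom (hT : IsTree T) (h : WellFounded (Child T)) (h' : WellFounded (Child T'))
    {u : List ℕ} (hu : nodeRank h [] ≤ nodeRank h' u) :
    ∃ F : List ℕ → List ℕ, F [] = u ∧ ∀ t s, Child T t s → Child T' (F t) (F s) := by
  have hnext : ∀ t u : List ℕ, ∃ u', nodeRank h t < nodeRank h' u →
      Child T' u' u ∧ nodeRank h t ≤ nodeRank h' u' := by
    intro t u
    by_cases ht : nodeRank h t < nodeRank h' u
    · obtain ⟨u', hu'⟩ := exists_child_of_lt h' ht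
      exact ⟨u', fun _ => hu'⟩
    · exact ⟨[], fun h => absurd h ht⟩
  choose next hnext using hnext
  let F : List ℕ → List ℕ := fun s =>
    List.reverseRecOn s u fun s a v => next (s ++ [a]) v
  have hF : ∀ s a, F (s ++ [a]) = next (s ++ [a]) (F s) := fun s a =>
    List.reverseRecOn_concat _ _ _ _
  have hchild : ∀ s a, s ++ [a] ∈ T → Child T (s ++ [a]) s := fun s a hs => ⟨hs, by simp, by simp⟩
  have hrank : ∀ s, s ∈ T → nodeRank h s ≤ nodeRank h' (F s) := by
    intro s
    induction s using List.reverseRecOn with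
    | nil => exact fun _ => by simpa [F] using hu
    | append_singleton s a ih =>
      intro hs
      rw [hF]
      exact (hnext _ _ ((nodeRank_lt h (hchild s a hs)).trans_le
        (ih (hT.2 _ _ (List.prefix_append _ _) hs)))).2
  refine ⟨F, by simp [F], ?_⟩
  rintro t s ⟨ht, hne, rfl⟩
  obtain ⟨s, a, rfl⟩ := (List.eq_nil_or_concat' t).resolve_left hne
  rw [List.dropLast_concat, hF]
  exact (hnext _ _ ((nodeRank_lt h (hchild s a ht)).trans_le
    (hrank s (hT.2 _ _ (List.prefix_append _ _) ht)))).1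

theorem treeLE_iff (hT : IsTree T) (h : WellFounded (Child T)) (h' : WellFounded (Child T')) :
    TreeLE T T' ↔ nodeRank h [] ≤ nodeRank h' [] := by
  constructor
  · rintro ⟨F, h0, hF⟩
    simpa [h0] using nodeRank_le_of_hom hF h h' []
  · exact exists_hom hT h h'

theorem treeLT_iff (hT : IsTree T) (h : WellFounded (Child T)) (h' : WellFounded (Child T')) :
    TreeLT T T' ↔ nodeRank h [] < nodeRank h' [] := by
  constructor
  · rintro ⟨F, h0, hF⟩
    exact (nodeRank_le_of_hom hF h h' []).trans_lt (nodeRank_lt h' h0)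
  · intro hlt
    obtain ⟨u, hu, hle⟩ := exists_child_of_lt h' hlt
    obtain ⟨F, h0, hF⟩ := exists_hom hT h h' hle
    exact ⟨F, h0 ▸ hu, hF⟩

end Compare

/-! ### Uniformization of `Π¹₁` relations in a number variable -/

/-- The tree of finite attempts at a witness `y` for `∃ y, ∀ t, R (i, x ↾ t, y ↾ t)`. The
condition at stage `t` is imposed from length `t + 1` on, so that the empty sequence always
belongs to the tree. -/
def treeOf (R : ι × List ℕ × List ℕ → Bool) (i : ι) (x : Baire) : Set (List ℕ) :=
  {s | ∀ t < s.length, R (i, initSeg x t, s.take t) = true}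

theorem isTree_treeOf {γ : Type} (R : γ × List ℕ × List ℕ → Bool) (i : γ) (x : Baire) :
    IsTree (treeOf R i x) := by
  refine ⟨fun t ht => absurd ht (by simp), fun s u hsu hu t ht => ?_⟩
  obtain ⟨v, rfl⟩ := hsu
  have := hu t (ht.trans_le (by simp))
  rwa [List.take_append_of_le_length ht.le] at this

theorem wellFounded_treeOf_iff {γ : Type} (R : γ × List ℕ × List ℕ → Bool) (i : γ) (x : Baire) :
    WellFounded (Child (treeOf R i x)) ↔ ¬ ∃ y, ∀ t, R (i, initSeg x t, initSeg y t) = true := by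
  rw [wellFounded_child_iff (isTree_treeOf R i x), not_iff_not]
  refine exists_congr fun y => ⟨fun H t => ?_, fun H t s hs => ?_⟩
  · simpa [take_initSeg] using H (t + 1) t (by simp)
  · rw [length_initSeg] at hs
    rw [take_initSeg _ hs.le]
    exact H s

theorem exists_primrec_mem_treeOf {R : ι × List ℕ × List ℕ → Bool} (hR : Primrec R) :
    ∃ M : ι × List ℕ × List ℕ → Bool, Primrec M ∧
      ∀ i x s, (M (i, initSeg x s.length, s) = true ↔ s ∈ treeOf R i x) := by
  have h1 : PrimrecRel fun (t : ℕ) (p : ι × List ℕ × List ℕ) =>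
      R (p.1, p.2.1.take t, p.2.2.take t) = true := by
    refine Primrec.eq.comp (hR.comp (Primrec.pair (Primrec.fst.comp Primrec.snd)
      (Primrec.pair ?_ ?_))) (Primrec.const true)
    · exact Primrec.list_take.comp Primrec.fst
        (Primrec.fst.comp (Primrec.snd.comp Primrec.snd))
    · exact Primrec.list_take.comp Primrec.fst
        (Primrec.snd.comp (Primrec.snd.comp Primrec.snd))
  have h2 : PrimrecPred fun p : ι × List ℕ × List ℕ =>
      ∀ t ∈ List.range p.2.2.length, R (p.1, p.2.1.take t, p.2.2.take t) = true :=
    PrimrecRel.comp (g := fun p => p) h1.forall_mem_list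
      (Primrec.list_range.comp (Primrec.list_length.comp (Primrec.snd.comp Primrec.snd))) Primrec.id
  obtain ⟨hd, h2⟩ := h2
  refine ⟨_, h2, fun i x s => ?_⟩
  simp only [decide_eq_true_eq, treeOf, Set.mem_ofPred_eq, List.mem_range]
  refine forall₂_congr fun t ht => ?_
  rw [take_initSeg x ht.le]

/-- A real coding a map on finite sequences. -/
def listMap (f : Baire) (s : List ℕ) : List ℕ :=
  Denumerable.ofNat (List ℕ) (f (Encodable.encode s))

theorem exists_listMap (F : List ℕ → List ℕ) : ∃ f, listMap f = F :=
  ⟨fun n => Encodable.encode (F (Denumerable.ofNat (List ℕ) n)), by funext s; simp [listMap]⟩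

theorem recFun_listMap {F : ι → Baire → Baire} (hF : RecMap F) {u : ι → List ℕ}
    (hu : Primrec u) : RecFun fun i w => listMap (F i w) (u i) :=
  RecFun.comp (Primrec.ofNat (List ℕ)) (RecFun.eval_map hF (Primrec.encode.comp hu))

theorem primrec_dropLast : Primrec (List.dropLast : List ℕ → List ℕ) :=
  (Primrec.list_take.comp (Primrec.nat_sub.comp Primrec.list_length (Primrec.const 1))
    Primrec.id).of_eq fun s => by simp [List.dropLast_eq_take]

variable {R : ι × List ℕ × List ℕ → Bool}

theorem recFun_treeOf (hR : Primrec R) {u : κ → ι} (hu : Primrec u) {F : κ → Baire → Baire}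
    (hF : RecMap F) {s : κ → List ℕ} (hs : Primrec s) :
    ∃ b : κ → Baire → Bool, RecFun b ∧ ∀ k w, b k w = true ↔ s k ∈ treeOf R (u k) (F k w) := by
  obtain ⟨M, hM, e⟩ := exists_primrec_mem_treeOf hR
  refine ⟨fun k w => M (u k, initSeg (F k w) (s k).length, s k), ?_, fun k w => e _ _ _⟩
  refine RecFun.comp hM ((RecFun.of_primrec hu).pair (RecFun.pair ?_ (RecFun.of_primrec hs)))
  exact RecFun.initSeg_map hF (Primrec.list_length.comp hs)

/-- For `RecFun` functionals `s` and `t` it is a closed condition that `t` is an immediate extension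
of `s` in the tree. The value of `t` is quantified over, since the length of the initial segment of
the real that decides membership in the tree depends on it. -/
theorem recClosed_child (hR : Primrec R) {u : κ → ι} (hu : Primrec u) {F : κ → Baire → Baire}
    (hF : RecMap F) {s t : κ → Baire → List ℕ} (hs : RecFun s) (ht : RecFun t) :
    RecClosed fun k w => Child (treeOf R (u k) (F k w)) (t k w) (s k w) := by
  obtain ⟨b, hb, e⟩ := recFun_treeOf (κ := κ × List ℕ) hR (hu.comp Primrec.fst)
    (hF.reindex Primrec.fst) Primrec.snd
  have h1 : RecFun fun (p : κ × List ℕ) w =>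
      (b p w || !decide (t p.1 w = p.2)) && (!decide (t p.1 w = [])) &&
        decide ((t p.1 w).dropLast = s p.1 w) := by
    refine RecFun.comp₂ (p := fun (p : κ × List ℕ) (a : Bool × List ℕ × List ℕ) =>
      (a.1 || !decide (a.2.1 = p.2)) && (!decide (a.2.1 = [])) &&
        decide (a.2.1.dropLast = a.2.2)) ?_
        (hb.pair ((ht.reindex Primrec.fst).pair (hs.reindex Primrec.fst)))
    have ha : Primrec fun q : (κ × List ℕ) × (Bool × List ℕ × List ℕ) => q.2.2.1 :=
      Primrec.fst.comp (Primrec.snd.comp Primrec.snd)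
    refine Primrec.and.comp (Primrec.and.comp (Primrec.or.comp (Primrec.fst.comp Primrec.snd)
      (Primrec.not.comp (primrecPred_iff_primrec_decide.1 (Primrec.eq.comp ha
        (Primrec.snd.comp Primrec.fst))))) (Primrec.not.comp (primrecPred_iff_primrec_decide.1
          (Primrec.eq.comp ha (Primrec.const []))))) (primrecPred_iff_primrec_decide.1
            (Primrec.eq.comp (primrec_dropLast.comp ha)
              (Primrec.snd.comp (Primrec.snd.comp Primrec.snd))))
  refine (RecClosed.of_recFun h1).all.congr fun k w => ?_
  simp only [Bool.and_eq_true, Bool.or_eq_true, e, Bool.not_eq_true', decide_eq_false_iff_not,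
    decide_eq_true_eq, Child]
  constructor
  · exact fun ⟨h1, h2, h3⟩ l => ⟨⟨or_iff_not_imp_right.2 fun h => not_not.1 h ▸ h1, h2⟩, h3⟩
  · intro H
    exact ⟨(H (t k w)).1.1.resolve_right (fun h => h rfl), (H []).1.2, (H []).2⟩

theorem recClosed_hom (hR : Primrec R) {u u' : κ → ι} (hu : Primrec u) (hu' : Primrec u') :
    RecClosed fun k w => ∀ t s, Child (treeOf R (u k) (left w)) t s →
      Child (treeOf R (u' k) (left w)) (listMap (right w) t) (listMap (right w) s) := by
  obtain ⟨b, hb, e⟩ := recFun_treeOf (κ := κ × List ℕ) (s := Prod.snd) hR (hu.comp Primrec.fst)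
    RecMap.id.left Primrec.snd
  have h1 : RecFun fun (p : κ × List ℕ) w => !b p w || decide (p.2 = []) := by
    refine RecFun.comp₂ (p := fun (p : κ × List ℕ) (a : Bool) => !a || decide (p.2 = [])) ?_ hb
    exact Primrec.or.comp (Primrec.not.comp Primrec.snd) (primrecPred_iff_primrec_decide.1
      (Primrec.eq.comp (Primrec.snd.comp Primrec.fst) (Primrec.const [])))
  have h2 := recClosed_child (κ := κ × List ℕ) hR (hu'.comp Primrec.fst) RecMap.id.left
    (recFun_listMap RecMap.id.right (primrec_dropLast.comp Primrec.snd))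
    (recFun_listMap RecMap.id.right Primrec.snd)
  refine (h2.or_recFun h1).all.congr fun k w => ?_
  have e' : ∀ t, b (k, t) w = false ↔ t ∉ treeOf R (u k) (left w) := fun t => by
    rw [← e (k, t) w, Bool.not_eq_true]
  simp only [Bool.or_eq_true, Bool.not_eq_true', e', decide_eq_true_eq]
  constructor
  · intro H t
    by_cases ht : t ∈ treeOf R (u k) (left w) ∧ t ≠ []
    · exact Or.inr (H t _ ⟨ht.1, ht.2, rfl⟩)
    · exact Or.inl (by tauto)
  · rintro H t s ⟨ht, hne, rfl⟩
    exact (H t).resolve_left (by tauto)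

theorem isSigma11_treeLE (hR : Primrec R) {u u' : κ → ι} (hu : Primrec u) (hu' : Primrec u') :
    IsSigma11 fun k x => TreeLE (treeOf R (u k) x) (treeOf R (u' k) x) := by
  have h1 : RecFun fun (_ : κ) w => decide (listMap (right w) [] = []) :=
    RecFun.comp (p := fun a : List ℕ => decide (a = [])) (primrecPred_iff_primrec_decide.1
      (Primrec.eq.comp Primrec.id (Primrec.const [])))
      (recFun_listMap RecMap.id.right (Primrec.const []))
  refine isSigma11_iff.2 ⟨_, (RecClosed.of_recFun h1).and (recClosed_hom hR hu hu'), fun k x => ?_⟩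
  simp only [left_join, right_join, decide_eq_true_eq]
  constructor
  · rintro ⟨F, hF⟩
    obtain ⟨f, rfl⟩ := exists_listMap F
    exact ⟨f, hF⟩
  · exact fun ⟨f, hf⟩ => ⟨_, hf⟩

theorem isSigma11_treeLT (hR : Primrec R) {u u' : κ → ι} (hu : Primrec u) (hu' : Primrec u') :
    IsSigma11 fun k x => TreeLT (treeOf R (u k) x) (treeOf R (u' k) x) := by
  have h1 : RecClosed fun (k : κ) w =>
      Child (treeOf R (u' k) (left w)) (listMap (right w) []) [] :=
    recClosed_child hR hu' RecMap.id.left (RecFun.of_primrec (Primrec.const []))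
      (recFun_listMap RecMap.id.right (Primrec.const []))
  refine isSigma11_iff.2 ⟨_, h1.and (recClosed_hom hR hu hu'), fun k x => ?_⟩
  simp only [left_join, right_join]
  constructor
  · rintro ⟨F, hF⟩
    obtain ⟨f, rfl⟩ := exists_listMap F
    exact ⟨f, hF⟩
  · exact fun ⟨f, hf⟩ => ⟨_, hf⟩

theorem IsSigma11.of_primrecPred {p : ι → Prop} (hp : PrimrecPred p) :
    IsSigma11 fun i (_ : Baire) => p i := by
  obtain ⟨hd, h⟩ := hp
  exact (IsSigma11.of_recFun (RecFun.of_primrec h)).congr fun i w => by simp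

/-- Uniformization of a `Π¹₁` relation in a discrete variable: among the `k` with `P (i, k) x`
select those whose tree has minimal rank, and among these the one with the least code. -/
theorem IsPi11.exists_uniformization {P : ι × κ → Baire → Prop} (hP : IsPi11 P) :
    ∃ P' : ι × κ → Baire → Prop, IsPi11 P' ∧ (∀ p x, P' p x → P p x) ∧
      (∀ i k k' x, P' (i, k) x → P' (i, k') x → k = k') ∧
      ∀ i x, (∃ k, P (i, k) x) → ∃ k, P' (i, k) x := by
  obtain ⟨R, hR, hPR⟩ := IsSigma11.exists_primrec hP
  have hwf : ∀ p x, P p x ↔ WellFounded (Child (treeOf R p x)) := fun p x => by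
    rw [wellFounded_treeOf_iff, ← hPR, not_not]
  let T : ι → κ → Baire → Set (List ℕ) := fun i k x => treeOf R (i, k) x
  have hT : ∀ i k x, IsTree (T i k x) := fun i k x => isTree_treeOf _ _ _
  let e : κ → ℕ := Encodable.encode
  refine ⟨fun p x => P p x ∧ ∀ k, (e k < e p.2 → ¬ TreeLE (T p.1 k x) (T p.1 p.2 x)) ∧
    (e p.2 < e k → ¬ TreeLT (T p.1 k x) (T p.1 p.2 x)), ?_, fun p x h => h.1, ?_, ?_⟩
  · have hu : Primrec fun q : (ι × κ) × κ => (q.1.1, q.2) :=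
      (Primrec.fst.comp Primrec.fst).pair Primrec.snd
    have he : Primrec fun q : (ι × κ) × κ => e q.2 := Primrec.encode.comp Primrec.snd
    have he' : Primrec fun q : (ι × κ) × κ => e q.1.2 :=
      Primrec.encode.comp (Primrec.snd.comp Primrec.fst)
    have h1 := (IsSigma11.of_primrecPred (Primrec.nat_lt.comp he he')).and
      (isSigma11_treeLE hR hu Primrec.fst)
    have h2 := (IsSigma11.of_primrecPred (Primrec.nat_lt.comp he' he)).and
      (isSigma11_treeLT hR hu Primrec.fst)
    refine (IsSigma11.or hP (h1.or h2).ex).congr fun p x => ?_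
    simp only [T, not_and_or, not_forall, not_not, exists_prop]
  · have key : ∀ i k k' x, P (i, k) x → P (i, k') x →
        ¬ TreeLE (T i k x) (T i k' x) → ¬ TreeLT (T i k' x) (T i k x) → False := by
      intro i k k' x hk hk' h1 h2
      rw [treeLE_iff (hT i k x) ((hwf _ _).1 hk) ((hwf _ _).1 hk')] at h1
      rw [treeLT_iff (hT i k' x) ((hwf _ _).1 hk') ((hwf _ _).1 hk)] at h2
      exact h2 (not_le.1 h1)
    rintro i k k' x ⟨hk, H⟩ ⟨hk', H'⟩
    rcases lt_trichotomy (e k) (e k') with h | h | h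
    · exact (key i k k' x hk hk' ((H' k).1 h) ((H k').2 h)).elim
    · exact Encodable.encode_injective h
    · exact (key i k' k x hk' hk ((H k').1 h) ((H' k).2 h)).elim
  · rintro i x ⟨k₀, hk₀⟩
    let S : Set Ordinal.{0} := {o | ∃ k, ∃ h : P (i, k) x, nodeRank ((hwf _ _).1 h) [] = o}
    obtain ⟨o, ⟨k₁, hk₁, rfl⟩, hmin⟩ := WellFounded.has_min Ordinal.lt_wf S ⟨_, k₀, hk₀, rfl⟩
    let N : Set ℕ := {n | ∃ k, ∃ h : P (i, k) x,
      nodeRank ((hwf _ _).1 h) [] = nodeRank ((hwf _ _).1 hk₁) [] ∧ e k = n}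
    obtain ⟨n, ⟨k, hk, hrk, rfl⟩, hmin'⟩ := WellFounded.has_min Nat.lt_wfRel.wf N
      ⟨_, k₁, hk₁, rfl, rfl⟩
    have hmin₂ : ∀ k' (h : P (i, k') x),
        nodeRank ((hwf _ _).1 hk) [] ≤ nodeRank ((hwf _ _).1 h) [] := fun k' h => by
      rw [hrk]; exact not_lt.1 (hmin _ ⟨k', h, rfl⟩)
    refine ⟨k, hk, fun k' => ⟨fun hlt hle => ?_, fun _ hlt => ?_⟩⟩
    · obtain ⟨F, h0, hF⟩ := hle
      have hk' : P (i, k') x := (hwf _ _).2 (wellFounded_of_hom hF ((hwf _ _).1 hk))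
      have hle := (treeLE_iff (hT i k' x) ((hwf _ _).1 hk') ((hwf _ _).1 hk)).1 ⟨F, h0, hF⟩
      exact hmin' _ ⟨k', hk', (le_antisymm hle (hmin₂ k' hk')).trans hrk, rfl⟩ hlt
    · obtain ⟨F, h0, hF⟩ := hlt
      have hk' : P (i, k') x := (hwf _ _).2 (wellFounded_of_hom hF ((hwf _ _).1 hk))
      have hlt := (treeLT_iff (hT i k' x) ((hwf _ _).1 hk') ((hwf _ _).1 hk)).1 ⟨F, h0, hF⟩
      exact absurd hlt (not_lt.2 (hmin₂ k' hk'))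

/-- Two disjoint `Σ¹₁` sets are separated by a `Δ¹₁` set. The complements of the two sets cover
Baire space, and uniformizing the resulting relation between reals and two indices splits the space
into two `Π¹₁` pieces. -/
theorem IsSigma11.exists_separation {A B : Set Baire}
    (hA : IsSigma11 fun (_ : Unit) x => x ∈ A) (hB : IsSigma11 fun (_ : Unit) x => x ∈ B)
    (hAB : Disjoint A B) : ∃ C, IsDelta11Set C ∧ A ⊆ C ∧ Disjoint B C := by
  have hk : IsPi11 fun (p : Unit × Bool) x =>
      (p.2 = false → x ∉ A) ∧ (p.2 = true → x ∉ B) := by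
    have h0 : ∀ b : Bool, PrimrecPred fun p : Unit × Bool => p.2 = b := fun b =>
      Primrec.eq.comp Primrec.snd (Primrec.const b)
    refine (((IsSigma11.of_primrecPred (h0 false)).and (hA.reindex Primrec.fst)).or
      ((IsSigma11.of_primrecPred (h0 true)).and (hB.reindex Primrec.fst))).congr fun p x => ?_
    simp only [not_and_or, Classical.not_imp, not_not]
  obtain ⟨P', hP', hsub, huniq, hex⟩ := hk.exists_uniformization
  have hcover : ∀ x, ∃ b, P' ((), b) x := fun x => by
    refine hex () x ?_
    by_cases hx : x ∈ A
    · exact ⟨true, by simp, fun _ => Set.disjoint_left.1 hAB hx⟩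
    · exact ⟨false, fun _ => hx, by simp⟩
  have hiff : ∀ x, P' ((), true) x ↔ ¬ P' ((), false) x := fun x => by
    constructor
    · exact fun h h' => absurd (huniq _ _ _ _ h h') (by simp)
    · intro h
      obtain ⟨b, hb⟩ := hcover x
      cases b
      · exact absurd hb h
      · exact hb
  have hpi : ∀ b, IsSigma11 fun (_ : Unit) x => ¬ P' ((), b) x := fun b =>
    IsSigma11.reindex (u := fun _ : Unit => ((), b)) hP' (Primrec.const _)
  refine ⟨{x | P' ((), true) x}, ⟨(hpi false).congr fun _ x => hiff x, hpi true⟩, fun x hx => ?_,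
    Set.disjoint_left.2 fun x hx h => (hsub _ _ h).2 rfl hx⟩
  exact (hiff x).2 fun h => (hsub _ _ h).1 rfl hx

/-! ### Turing reducibility: computing with oracles -/

theorem turingLE_iff {x y : Baire} :
    TuringLE x y ↔ Nat.RecursiveIn {(y : ℕ →. ℕ)} (x : ℕ →. ℕ) := RecursiveIn.iff_nat

namespace TuringLE

variable {x y z f g : Baire}

protected theorem refl (x : Baire) : TuringLE x x := TuringReducible.refl _

protected theorem trans (h : TuringLE x y) (h' : TuringLE y z) : TuringLE x z :=
  TuringReducible.trans h h'

theorem of_primrec (hf : Primrec f) : TuringLE f x :=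
  turingLE_iff.2 (Nat.Primrec.recursiveIn (Primrec.nat_iff.1 hf))

theorem comp (hf : TuringLE f x) (hg : TuringLE g x) : TuringLE (fun n => f (g n)) x :=
  turingLE_iff.2 ((Nat.RecursiveIn.comp (turingLE_iff.1 hf) (turingLE_iff.1 hg)).of_eq
    fun n => Part.bind_some (g n) (f : ℕ →. ℕ))

theorem pair (hf : TuringLE f x) (hg : TuringLE g x) :
    TuringLE (fun n => Nat.pair (f n) (g n)) x :=
  turingLE_iff.2 ((Nat.RecursiveIn.pair (turingLE_iff.1 hf) (turingLE_iff.1 hg)).of_eq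
    fun n => by simp [Seq.seq])

theorem map₂ {p : ℕ → ℕ → ℕ} (hp : Primrec₂ p) (hf : TuringLE f x) (hg : TuringLE g x) :
    TuringLE (fun n => p (f n) (g n)) x := by
  have := comp (of_primrec (x := x) (f := fun n => p n.unpair.1 n.unpair.2)
    (hp.comp (Primrec.fst.comp Primrec.unpair) (Primrec.snd.comp Primrec.unpair))) (hf.pair hg)
  simpa using this

theorem nat_rec (a : ℕ) (hf : TuringLE f x) :
    TuringLE (fun n => Nat.rec a (fun t i => f (Nat.pair t i)) n) x := by
  have h1 : TuringLE (fun p => f p.unpair.2) x :=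
    hf.comp (of_primrec (Primrec.snd.comp Primrec.unpair))
  have h2 : TuringLE (fun n => Nat.pair 0 n) x :=
    of_primrec (Primrec₂.natPair.comp (Primrec.const 0) Primrec.id)
  have h3 := Nat.RecursiveIn.comp (Nat.RecursiveIn.prec
    (turingLE_iff.1 (of_primrec (x := x) (Primrec.const a))) (turingLE_iff.1 h1))
    (turingLE_iff.1 h2)
  refine turingLE_iff.2 (h3.of_eq fun n => ?_)
  simp only [PFun.coe_val, Part.bind_eq_bind, Part.bind_some, Nat.unpair_pair]
  induction n with
  | zero => rfl
  | succ n ih => simp only [ih, Part.bind_some]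

theorem initSeg (x : Baire) : TuringLE (fun t => Encodable.encode (initSeg x t)) x := by
  have hp : Primrec₂ fun (p v : ℕ) =>
      Encodable.encode (Denumerable.ofNat (List ℕ) p.unpair.2 ++ [v]) :=
    Primrec.encode.comp (Primrec.list_concat.comp ((Primrec.ofNat _).comp
      (Primrec.snd.comp (Primrec.unpair.comp Primrec.fst))) Primrec.snd)
  have h := nat_rec (Encodable.encode ([] : List ℕ)) (map₂ hp (of_primrec (x := x) Primrec.id)
    ((TuringLE.refl x).comp (of_primrec (Primrec.fst.comp Primrec.unpair))))
  convert h using 2 with t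
  induction t with
  | zero => rfl
  | succ t ih => rw [initSeg_succ]; simp only [← ih]; simp

theorem of_recFun {h : ℕ → Baire → ℕ} (hh : RecFun h) (x : Baire) :
    TuringLE (fun n => h n x) x := by
  obtain ⟨g, H, hg, hH, e⟩ := hh
  have hp : Primrec₂ fun n v : ℕ => H (n, Denumerable.ofNat (List ℕ) v) :=
    hH.comp (Primrec.fst.pair ((Primrec.ofNat _).comp Primrec.snd))
  convert map₂ hp (of_primrec (x := x) Primrec.id) ((initSeg x).comp (of_primrec hg)) using 2 with n
  rw [e n x (g n) le_rfl]
  simp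

theorem of_recMap {F : Unit → Baire → Baire} (hF : RecMap F) (x : Baire) :
    TuringLE (F () x) x :=
  of_recFun (h := fun n w => F () w n) (RecFun.reindex ((Primrec.const ()).pair Primrec.id) hF) x

theorem left (w : Baire) : TuringLE (left w) w := of_recMap RecMap.id.left w

theorem right (w : Baire) : TuringLE (right w) w := of_recMap RecMap.id.right w

theorem column (w : Baire) (k : ℕ) : TuringLE (column w k) w :=
  of_recMap (RecMap.id.column (Primrec.const k)) w

theorem join (hx : TuringLE x z) (hy : TuringLE y z) : TuringLE (join x y) z := by
  have hd : TuringLE Nat.div2 z := of_primrec Primrec.nat_div2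
  have hp : Primrec₂ fun n v : ℕ => bif n.bodd then v.unpair.2 else v.unpair.1 :=
    Primrec.cond (Primrec.nat_bodd.comp Primrec.fst)
      (Primrec.snd.comp (Primrec.unpair.comp Primrec.snd))
      (Primrec.fst.comp (Primrec.unpair.comp Primrec.snd))
  convert map₂ hp (of_primrec (x := z) Primrec.id) ((hx.comp hd).pair (hy.comp hd)) using 2 with n
  simp [Baire.join]

/-- Unbounded search: `y n` is the value found at the first stage at which one is found. -/
theorem of_search {B : ℕ × ℕ → Baire → Option ℕ} (hB : RecFun B)
    (hex : ∀ n, ∃ s, (B (n, s) x).isSome) (hval : ∀ n s m, B (n, s) x = some m → m = y n) :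
    TuringLE y x := by
  have hb : TuringLE (fun p => Encodable.encode (B p.unpair x)) x :=
    of_recFun (RecFun.comp Primrec.encode (RecFun.reindex Primrec.unpair hB)) x
  have hz : TuringLE (fun p => 1 - Encodable.encode (B p.unpair x)) x :=
    comp (f := fun n => 1 - n) (of_primrec (Primrec.nat_sub.comp (Primrec.const 1) Primrec.id)) hb
  have hbn : ∀ n s, Encodable.encode (B (n, s) x) = 0 ∨
      Encodable.encode (B (n, s) x) = y n + 1 := by
    intro n s
    cases h : B (n, s) x with
    | none => exact Or.inl rfl
    | some m => right; rw [hval n s m h]; rfl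
  have hfind : ∀ n, ∃ s, Encodable.encode (B (n, s) x) = y n + 1 ∧
      ∀ s' < s, Encodable.encode (B (n, s') x) = 0 := by
    intro n
    have hex' : ∃ s, Encodable.encode (B (n, s) x) ≠ 0 := by
      obtain ⟨s, hs⟩ := hex n
      obtain ⟨m, hm⟩ := Option.isSome_iff_exists.1 hs
      exact ⟨s, by simp [hm]⟩
    classical
    exact ⟨Nat.find hex', (hbn _ _).resolve_left (Nat.find_spec hex'),
      fun s' hs' => not_not.1 (Nat.find_min hex' hs')⟩
  choose s hs hs' using hfind
  have hS : TuringLE s x := by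
    refine turingLE_iff.2 ((Nat.RecursiveIn.rfind (turingLE_iff.1 hz)).of_eq fun n => ?_)
    refine Part.eq_some_iff.2 (Nat.mem_rfind.2 ⟨?_, fun {s'} h => ?_⟩)
    · simp [hs]
    · simp [hs' n s' h]
  have hv := comp (f := Nat.pred) (of_primrec Primrec.pred)
    (hb.comp ((of_primrec (x := x) Primrec.id).pair hS))
  convert hv using 2 with n
  simp [hs]

end TuringLE

/-! ### The use principle -/

/-- The functional `Φ`, acting on finite oracles, approximates the partial function `f` along the
oracle `x`. -/
structure Approximates (Φ : List ℕ → ℕ → Option ℕ) (x : Baire) (f : ℕ →. ℕ) : Prop where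
  mono : ∀ {l l' n m}, l <+: l' → Φ l n = some m → Φ l' n = some m
  mem_iff : ∀ {n m}, m ∈ f n ↔ ∃ t, Φ (initSeg x t) n = some m

theorem initSeg_prefix (x : Baire) {s t : ℕ} (h : s ≤ t) : initSeg x s <+: initSeg x t :=
  take_initSeg x h ▸ List.take_prefix _ _

theorem Approximates.of_le {Φ : List ℕ → ℕ → Option ℕ} {x : Baire} {f : ℕ →. ℕ}
    (h : Approximates Φ x f) {s t n m : ℕ} (hst : s ≤ t) (hs : Φ (initSeg x s) n = some m) :
    Φ (initSeg x t) n = some m := h.mono (initSeg_prefix x hst) hs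

/-- Every function recursive in an oracle is approximated by a primitive recursive functional on
finite oracles; searches are bounded by the length of the finite oracle. -/
theorem exists_approximates {x : Baire} {f : ℕ →. ℕ} (hf : Nat.RecursiveIn {(x : ℕ →. ℕ)} f) :
    ∃ Φ : List ℕ → ℕ → Option ℕ, Primrec₂ Φ ∧ Approximates Φ x f := by
  have base : ∀ g : ℕ → ℕ, Primrec g → ∃ Φ : List ℕ → ℕ → Option ℕ, Primrec₂ Φ ∧
      Approximates Φ x (g : ℕ →. ℕ) := fun g hg =>
    ⟨fun _ n => some (g n), Primrec.option_some.comp (hg.comp Primrec.snd),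
      fun _ h => h, by simp [eq_comm]⟩
  induction hf with
  | zero => exact base _ (Primrec.const 0)
  | succ => exact base _ Primrec.succ
  | left => exact base _ (Primrec.fst.comp Primrec.unpair)
  | right => exact base _ (Primrec.snd.comp Primrec.unpair)
  | oracle g hg =>
    obtain rfl := Set.mem_singleton_iff.1 hg
    refine ⟨fun l n => l[n]?, Primrec.list_getElem?, ?_, ?_⟩
    · rintro l _ n m ⟨v, rfl⟩ h
      obtain ⟨hn, h⟩ := List.getElem?_eq_some_iff.1 h
      rw [List.getElem?_append_left hn, List.getElem?_eq_getElem hn, h]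
    · intro n m
      simp only [PFun.coe_val, Part.mem_some_iff]
      constructor
      · rintro rfl
        exact ⟨n + 1, by simp [initSeg]⟩
      · rintro ⟨t, ht⟩
        obtain ⟨hn, h⟩ := List.getElem?_eq_some_iff.1 ht
        simpa [initSeg] using h.symm
  | @pair f h _ _ ihf ihh =>
    obtain ⟨Φ, hΦ, aΦ⟩ := ihf
    obtain ⟨Ψ, hΨ, aΨ⟩ := ihh
    refine ⟨fun l n => (Φ l n).bind fun a => (Ψ l n).map fun b => Nat.pair a b, ?_, ?_, ?_⟩
    · refine Primrec.option_bind hΦ (Primrec.option_map (hΨ.comp (Primrec.fst.comp Primrec.fst)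
        (Primrec.snd.comp Primrec.fst)) ?_)
      exact Primrec₂.natPair.comp (Primrec.snd.comp Primrec.fst) Primrec.snd
    · intro l l' n m hl h
      simp only [Option.bind_eq_some_iff, Option.map_eq_some_iff] at h ⊢
      obtain ⟨a, ha, b, hb, e⟩ := h
      exact ⟨a, aΦ.mono hl ha, b, aΨ.mono hl hb, e⟩
    · intro n m
      simp only [Option.bind_eq_some_iff, Option.map_eq_some_iff, Seq.seq, Part.map_eq_map,
        Part.mem_bind_iff, Part.mem_map_iff, exists_exists_and_eq_and]
      constructor
      · rintro ⟨a, ha, b, hb, e⟩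
        obtain ⟨s, hs⟩ := aΦ.mem_iff.1 ha
        obtain ⟨t, ht⟩ := aΨ.mem_iff.1 hb
        exact ⟨max s t, a, aΦ.of_le (le_max_left _ _) hs, b, aΨ.of_le (le_max_right _ _) ht, e⟩
      · rintro ⟨t, a, ha, b, hb, e⟩
        exact ⟨a, aΦ.mem_iff.2 ⟨t, ha⟩, b, aΨ.mem_iff.2 ⟨t, hb⟩, e⟩
  | @comp f h _ _ ihf ihh =>
    obtain ⟨Φ, hΦ, aΦ⟩ := ihf
    obtain ⟨Ψ, hΨ, aΨ⟩ := ihh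
    refine ⟨fun l n => (Ψ l n).bind fun a => Φ l a, ?_, ?_, ?_⟩
    · exact Primrec.option_bind hΨ (hΦ.comp (Primrec.fst.comp Primrec.fst) Primrec.snd)
    · intro l l' n m hl h
      simp only [Option.bind_eq_some_iff] at h ⊢
      obtain ⟨a, ha, hb⟩ := h
      exact ⟨a, aΨ.mono hl ha, aΦ.mono hl hb⟩
    · intro n m
      simp only [Option.bind_eq_some_iff]
      refine (Part.mem_bind_iff (f := h n) (g := f)).trans ?_
      constructor
      · rintro ⟨a, ha, hb⟩
        obtain ⟨s, hs⟩ := aΨ.mem_iff.1 ha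
        obtain ⟨t, ht⟩ := aΦ.mem_iff.1 hb
        exact ⟨max s t, a, aΨ.of_le (le_max_left _ _) hs, aΦ.of_le (le_max_right _ _) ht⟩
      · rintro ⟨t, a, ha, hb⟩
        exact ⟨a, aΨ.mem_iff.2 ⟨t, ha⟩, aΦ.mem_iff.2 ⟨t, hb⟩⟩
  | @prec f h _ _ ihf ihh =>
    obtain ⟨Φ, hΦ, aΦ⟩ := ihf
    obtain ⟨Ψ, hΨ, aΨ⟩ := ihh
    let Θ : List ℕ → ℕ → ℕ → Option ℕ := fun l a k => Nat.rec (Φ l a)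
      (fun y (IH : Option ℕ) => IH.bind fun i => Ψ l (Nat.pair a (Nat.pair y i))) k
    have hmono : ∀ {l l'} a k m, l <+: l' → Θ l a k = some m → Θ l' a k = some m := by
      intro l l' a k m hl h
      induction k generalizing m with
      | zero => exact aΦ.mono hl h
      | succ k ih =>
        obtain ⟨i, hi, h⟩ := Option.bind_eq_some_iff.1 h
        exact Option.bind_eq_some_iff.2 ⟨i, ih i hi, aΨ.mono hl h⟩
    refine ⟨fun l p => Θ l p.unpair.1 p.unpair.2, ?_, fun hl h => hmono _ _ _ hl h, ?_⟩
    · have h1 : Primrec fun q : List ℕ × ℕ => Φ q.1 q.2.unpair.1 :=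
        hΦ.comp Primrec.fst (Primrec.fst.comp (Primrec.unpair.comp Primrec.snd))
      have h2 : Primrec₂ fun (q : List ℕ × ℕ) (r : ℕ × Option ℕ) =>
          r.2.bind fun i => Ψ q.1 (Nat.pair q.2.unpair.1 (Nat.pair r.1 i)) := by
        refine Primrec.option_bind (Primrec.snd.comp Primrec.snd) (hΨ.comp
          (Primrec.fst.comp (Primrec.fst.comp Primrec.fst)) (Primrec₂.natPair.comp
            (Primrec.fst.comp (Primrec.unpair.comp (Primrec.snd.comp
              (Primrec.fst.comp Primrec.fst)))) (Primrec₂.natPair.comp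
                (Primrec.fst.comp (Primrec.snd.comp Primrec.fst)) Primrec.snd)))
      exact Primrec.nat_rec' (Primrec.snd.comp (Primrec.unpair.comp Primrec.snd)) h1 h2
    · intro p m
      simp only
      generalize p.unpair.1 = a, p.unpair.2 = k
      induction k generalizing m with
      | zero => exact aΦ.mem_iff
      | succ k ih =>
        simp only [Part.bind_eq_bind, Part.mem_bind_iff]
        constructor
        · rintro ⟨i, hi, hm⟩
          obtain ⟨s, hs⟩ := ih.1 hi
          obtain ⟨t, ht⟩ := aΨ.mem_iff.1 hm
          exact ⟨max s t, Option.bind_eq_some_iff.2 ⟨i,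
            hmono _ _ _ (initSeg_prefix x (le_max_left _ _)) hs,
            aΨ.of_le (le_max_right _ _) ht⟩⟩
        · rintro ⟨t, ht⟩
          obtain ⟨i, hi, h⟩ := Option.bind_eq_some_iff.1 ht
          exact ⟨i, ih.2 ⟨t, hi⟩, aΨ.mem_iff.2 ⟨t, h⟩⟩
  | @rfind f _ ih =>
    obtain ⟨Φ, hΦ, aΦ⟩ := ih
    -- `N` says that the search cannot go past `k`: the value at `k` is zero or not yet known.
    let N : List ℕ → ℕ → ℕ → Bool := fun l a k =>
      !decide (1 < Encodable.encode (Φ l (Nat.pair a k)))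
    let I : List ℕ → ℕ → ℕ := fun l a => (List.range l.length).findIdx (N l a)
    have hN : ∀ l a k, N l a k = false ↔ ∃ v, Φ l (Nat.pair a k) = some (v + 1) := by
      intro l a k
      rcases h : Φ l (Nat.pair a k) with _ | _ | v <;> simp [N, h]
    have hpI : Primrec₂ I := by
      refine Primrec.list_findIdx
        (Primrec.list_range.comp (Primrec.list_length.comp Primrec.fst)) ?_
      refine Primrec.not.comp (primrecPred_iff_primrec_decide.1 (Primrec.nat_lt.comp
        (Primrec.const 1) (Primrec.encode.comp (hΦ.comp (Primrec.fst.comp Primrec.fst)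
          (Primrec₂.natPair.comp (Primrec.snd.comp Primrec.fst) Primrec.snd)))))
    have hspec : ∀ l a m,
        (if Φ l (Nat.pair a (I l a)) = some 0 then some (I l a) else none) = some m ↔
          m ≤ l.length ∧ Φ l (Nat.pair a m) = some 0 ∧
            ∀ k < m, ∃ v, Φ l (Nat.pair a k) = some (v + 1) := by
      intro l a m
      have hle : I l a ≤ l.length := by
        simpa using (List.findIdx_le_length : I l a ≤ (List.range l.length).length)
      have hbelow : ∀ k < I l a, ∃ v, Φ l (Nat.pair a k) = some (v + 1) := fun k hk => by
        rw [← hN]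
        have := List.not_of_lt_findIdx (p := N l a) (xs := List.range l.length) hk
        simpa using this
      constructor
      · intro h
        split_ifs at h with h0
        obtain rfl := Option.some_injective _ h
        exact ⟨hle, h0, hbelow⟩
      · rintro ⟨hm, h0, hk⟩
        have : I l a = m := by
          refine le_antisymm ?_ ?_
          · by_contra hlt
            obtain ⟨v, hv⟩ := hbelow m (not_le.1 hlt)
            rw [h0] at hv; simp at hv
          · by_contra hlt
            push Not at hlt
            have hlt' : I l a < (List.range l.length).length := by
              simpa using hlt.trans_le hm
            have h1 := List.findIdx_getElem (p := N l a) (xs := List.range l.length) (w := hlt')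
            rw [List.getElem_range] at h1
            have h2 := (hN l a (I l a)).2 (hk _ hlt)
            exact absurd (h1.symm.trans h2) (by simp)
        rw [this, if_pos h0]
    refine ⟨fun l a => if Φ l (Nat.pair a (I l a)) = some 0 then some (I l a) else none, ?_, ?_, ?_⟩
    · refine Primrec.ite (Primrec.eq.comp
        (hΦ.comp Primrec.fst (Primrec₂.natPair.comp Primrec.snd hpI)) (Primrec.const (some 0)))
        (Primrec.option_some.comp hpI) (Primrec.const none)
    · intro l l' n m hl h
      rw [hspec] at h ⊢
      exact ⟨h.1.trans hl.length_le, aΦ.mono hl h.2.1, fun k hk =>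
        (h.2.2 k hk).imp fun v hv => aΦ.mono hl hv⟩
    · intro a m
      simp only [hspec, length_initSeg]
      refine Nat.mem_rfind.trans ?_
      simp only [Part.map_eq_map, Part.mem_map_iff, decide_eq_true_eq, decide_eq_false_iff_not]
      constructor
      · rintro ⟨⟨_, h0, rfl⟩, hk⟩
        obtain ⟨t, ht⟩ := aΦ.mem_iff.1 h0
        have : ∀ k, ∃ s, k < m → ∃ v, Φ (initSeg x s) (Nat.pair a k) = some (v + 1) := by
          intro k
          by_cases hkm : k < m
          · obtain ⟨v, hv, hv0⟩ := hk hkm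
            obtain ⟨s, hs⟩ := aΦ.mem_iff.1 hv
            obtain ⟨v, rfl⟩ := Nat.exists_eq_succ_of_ne_zero hv0
            exact ⟨s, fun _ => ⟨v, hs⟩⟩
          · exact ⟨0, fun h => absurd h hkm⟩
        choose s hs using this
        let S := (Finset.range m).sup s
        refine ⟨max m (max t S), le_max_left _ _,
          aΦ.of_le ((le_max_left _ _).trans (le_max_right _ _)) ht, fun k hkm => ?_⟩
        obtain ⟨v, hv⟩ := hs k hkm
        exact ⟨v, aΦ.of_le (((Finset.le_sup (f := s) (Finset.mem_range.2 hkm)).trans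
          (le_max_right t S)).trans (le_max_right _ _)) hv⟩
      · rintro ⟨t, _, h0, hk⟩
        refine ⟨⟨0, aΦ.mem_iff.2 ⟨t, h0⟩, rfl⟩, fun {k} hkm => ?_⟩
        obtain ⟨v, hv⟩ := hk k hkm
        exact ⟨v + 1, aΦ.mem_iff.2 ⟨t, hv⟩, by simp⟩

/-! ### Turing reducibility is `Δ¹₁` -/

/-- Lightface `Δ¹₁` relations. -/
def IsDelta11 (P : ι → Baire → Prop) : Prop := IsSigma11 P ∧ IsPi11 P

namespace IsDelta11

theorem congr {P P' : ι → Baire → Prop} (h : IsDelta11 P) (e : ∀ i w, P' i w ↔ P i w) :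
    IsDelta11 P' :=
  ⟨h.1.congr e, IsSigma11.congr h.2 fun i w => not_congr (e i w)⟩

theorem not {P : ι → Baire → Prop} (h : IsDelta11 P) : IsDelta11 fun i w => ¬ P i w :=
  ⟨h.2, h.1.congr fun _ _ => not_not⟩

theorem of_recFun {b : ι → Baire → Bool} (hb : RecFun b) : IsDelta11 fun i w => b i w = true :=
  ⟨.of_recFun hb, (IsSigma11.of_recFun (RecFun.comp Primrec.not hb)).congr fun _ _ => by simp⟩

theorem and {P P' : ι → Baire → Prop} (h : IsDelta11 P) (h' : IsDelta11 P') :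
    IsDelta11 fun i w => P i w ∧ P' i w :=
  ⟨h.1.and h'.1, (IsSigma11.or h.2 h'.2).congr fun _ _ => not_and_or⟩

theorem or {P P' : ι → Baire → Prop} (h : IsDelta11 P) (h' : IsDelta11 P') :
    IsDelta11 fun i w => P i w ∨ P' i w :=
  (h.not.and h'.not).not.congr fun _ _ => or_iff_not_and_not

theorem all {P : ι × κ → Baire → Prop} (h : IsDelta11 P) : IsDelta11 fun i w => ∀ k, P (i, k) w :=
  ⟨h.1.all, (IsSigma11.ex h.2).congr fun _ _ => not_forall⟩

theorem ex {P : ι × κ → Baire → Prop} (h : IsDelta11 P) : IsDelta11 fun i w => ∃ k, P (i, k) w :=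
  ⟨h.1.ex, (IsSigma11.all h.2).congr fun _ _ => not_exists⟩

theorem subst {P : κ → Baire → Prop} (h : IsDelta11 P) {u : ι → κ} (hu : Primrec u)
    {F : ι → Baire → Baire} (hF : RecMap F) : IsDelta11 fun i w => P (u i) (F i w) :=
  ⟨h.1.subst hu hF, IsSigma11.subst h.2 hu hF⟩

end IsDelta11

/-- The computation with oracle `x` of machine `c` on input `n`, where `s.1` is the length of the
part of the oracle given to the machine and `s.2` a bound on the running time. -/
def oracleRun (c : Code) (n : ℕ) (s : ℕ × ℕ) (x : Baire) : Option ℕ :=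
  Code.evaln s.2 c (Encodable.encode (initSeg x s.1, n))

theorem recFun_oracleRun :
    RecFun fun (p : (Code × ℕ) × (ℕ × ℕ)) x => oracleRun p.1.1 p.1.2 p.2 x := by
  have h : RecFun fun (p : (Code × ℕ) × (ℕ × ℕ)) x => initSeg x p.2.1 :=
    RecFun.initSeg (Primrec.fst.comp Primrec.snd)
  refine RecFun.comp₂ (p := fun (p : (Code × ℕ) × (ℕ × ℕ)) (l : List ℕ) =>
    Code.evaln p.2.2 p.1.1 (Encodable.encode (l, p.1.2))) ?_ h
  exact Code.primrec_evaln.comp (Primrec.pair (Primrec.pair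
    (Primrec.snd.comp (Primrec.snd.comp Primrec.fst))
    (Primrec.fst.comp (Primrec.fst.comp Primrec.fst)))
    (Primrec.encode.comp (Primrec.snd.pair (Primrec.snd.comp (Primrec.fst.comp Primrec.fst)))))

/-- Machine `c` with oracle `x` has the value `m` on input `n`: some computation yields `m`, and no
computation yields anything else. -/
def OracleValue (c : Code) (n m : ℕ) (x : Baire) : Prop :=
  (∃ s, oracleRun c n s x = some m) ∧ ∀ s m', oracleRun c n s x = some m' → m' = m

/-- Machine `c` computes `y` from the oracle `x`. -/
def Computes (c : Code) (x y : Baire) : Prop := ∀ n, OracleValue c n (y n) x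

theorem OracleValue.unique {c : Code} {n m m' : ℕ} {x : Baire} (h : OracleValue c n m x)
    (h' : OracleValue c n m' x) : m = m' :=
  let ⟨s, hs⟩ := h.1
  h'.2 s m hs

theorem Computes.unique {c : Code} {x y y' : Baire} (h : Computes c x y) (h' : Computes c x y') :
    y = y' := funext fun n => (h n).unique (h' n)

theorem isDelta11_oracleValue :
    IsDelta11 fun (p : (Code × ℕ) × ℕ) x => OracleValue p.1.1 p.1.2 p.2 x := by
  have h1 : RecFun fun (p : ((Code × ℕ) × ℕ) × (ℕ × ℕ)) x =>
      decide (oracleRun p.1.1.1 p.1.1.2 p.2 x = some p.1.2) := by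
    refine RecFun.comp₂ (p := fun (p : ((Code × ℕ) × ℕ) × (ℕ × ℕ)) (o : Option ℕ) =>
      decide (o = some p.1.2)) ?_ (recFun_oracleRun.reindex
        (u := fun p : ((Code × ℕ) × ℕ) × (ℕ × ℕ) => (p.1.1, p.2))
        ((Primrec.fst.comp Primrec.fst).pair Primrec.snd))
    exact primrecPred_iff_primrec_decide.1 (Primrec.eq.comp Primrec.snd
      (Primrec.option_some.comp (Primrec.snd.comp (Primrec.fst.comp Primrec.fst))))
  have h2 : RecFun fun (p : (((Code × ℕ) × ℕ) × (ℕ × ℕ)) × ℕ) (_ : Baire) =>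
      decide (p.2 = p.1.1.2) :=
    RecFun.of_primrec (primrecPred_iff_primrec_decide.1 (Primrec.eq.comp Primrec.snd
      (Primrec.snd.comp (Primrec.fst.comp Primrec.fst))))
  have h3 := h1.reindex (u := fun p : (((Code × ℕ) × ℕ) × (ℕ × ℕ)) × ℕ =>
    ((p.1.1.1, p.2), p.1.2)) (((Primrec.fst.comp (Primrec.fst.comp Primrec.fst)).pair
      Primrec.snd).pair (Primrec.snd.comp Primrec.fst))
  refine ((IsDelta11.of_recFun h1).ex.and (((IsDelta11.of_recFun h3).not.or
    (IsDelta11.of_recFun h2)).all.all)).congr fun p x => ?_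
  simp only [OracleValue, decide_eq_true_eq, imp_iff_not_or]

theorem isDelta11_computes : IsDelta11 fun (c : Code) w => Computes c (left w) (right w) := by
  have h1 : RecFun fun (p : (Code × ℕ) × ℕ) w => decide (right w p.1.2 = p.2) := by
    refine RecFun.comp₂ (p := fun (p : (Code × ℕ) × ℕ) (v : ℕ) => decide (v = p.2)) ?_
      (RecFun.eval_map RecMap.id.right (Primrec.snd.comp Primrec.fst))
    exact primrecPred_iff_primrec_decide.1 (Primrec.eq.comp Primrec.snd
      (Primrec.snd.comp Primrec.fst))
  refine ((IsDelta11.of_recFun h1).not.or (isDelta11_oracleValue.subst Primrec.id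
    RecMap.id.left)).all.all.congr fun c w => ?_
  simp only [Computes, decide_eq_true_eq, id, ← imp_iff_not_or, forall_eq']

/-- Approximating functionals are turned into machines by exhausting running times; conversely, a
machine is run on all finite parts of the oracle until a computation halts. -/
theorem turingLE_iff_exists_computes {x y : Baire} : TuringLE y x ↔ ∃ c, Computes c x y := by
  constructor
  · intro h
    obtain ⟨Φ, hΦ, aΦ⟩ := exists_approximates (turingLE_iff.1 h)
    have hp : Partrec fun p : List ℕ × ℕ => (Φ p.1 p.2 : Part ℕ) :=
      Computable.ofOption (Primrec.to_comp hΦ)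
    obtain ⟨c, hc⟩ := Code.exists_code.1 hp
    have hc' : ∀ l n, Code.eval c (Encodable.encode (l, n)) = (Φ l n : Part ℕ) := by
      intro l n
      rw [hc]
      simp only [Encodable.encodek, Part.coe_some, Part.bind_some]
      exact Part.map_id' (fun _ => rfl) _
    refine ⟨c, fun n => ⟨?_, fun s m' hs => ?_⟩⟩
    · obtain ⟨t, ht⟩ := (aΦ.mem_iff (n := n) (m := y n)).1 (Part.mem_some _)
      have : y n ∈ Code.eval c (Encodable.encode (initSeg x t, n)) := by
        rw [hc', ht]; exact Part.mem_some _
      obtain ⟨k, hk⟩ := Code.evaln_complete.1 this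
      exact ⟨(t, k), hk⟩
    · have := Code.evaln_sound (Option.mem_def.2 hs)
      rw [hc', Part.mem_ofOption] at this
      exact Part.mem_some_iff.1 ((aΦ.mem_iff (n := n) (m := m')).2 ⟨_, this⟩)
  · rintro ⟨c, hc⟩
    refine TuringLE.of_search (B := fun p x => oracleRun c p.1 p.2.unpair x)
      (recFun_oracleRun.reindex (u := fun p : ℕ × ℕ => ((c, p.1), p.2.unpair))
        (((Primrec.const c).pair Primrec.fst).pair (Primrec.unpair.comp Primrec.snd)))
      (fun n => ?_) (fun n s m h => (hc n).2 _ m h)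
    obtain ⟨s, hs⟩ := (hc n).1
    exact ⟨Nat.pair s.1 s.2, by simp [hs]⟩

theorem isDelta11_turingLE : IsDelta11 fun (_ : ι) w => TuringLE (right w) (left w) := by
  refine (isDelta11_computes.subst (ι := ι × Code) Primrec.snd RecMap.id).ex.congr fun i w => ?_
  exact turingLE_iff_exists_computes

/-- The largest Turing closed subset of a set of reals. -/
def turingCore (A : Set Baire) : Set Baire := {x | ∀ y, TuringEq x y → y ∈ A}

theorem turingCore_subset (A : Set Baire) : turingCore A ⊆ A :=
  fun x hx => hx x ⟨.refl x, .refl x⟩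

theorem turingClosed_turingCore (A : Set Baire) : TuringClosed (turingCore A) :=
  fun _ _ h hx z hz => hx z ⟨h.1.trans hz.1, hz.2.trans h.2⟩

theorem TuringClosed.subset_turingCore {A B : Set Baire} (hA : TuringClosed A) (h : A ⊆ B) :
    A ⊆ turingCore B := fun _ hx _ hy => h (hA _ _ hy hx)

/-- The Turing core of a `Δ¹₁` set is `Δ¹₁`. It is `Π¹₁` by definition; it is `Σ¹₁` since the
quantifier over the reals Turing equivalent to `x` amounts to a quantifier over machines. -/
theorem IsDelta11Set.turingCore {A : Set Baire} (hA : IsDelta11Set A) :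
    IsDelta11Set (turingCore A) := by
  have hsub : ∀ {ι : Type} [Primcodable ι], IsDelta11 fun (_ : ι) w => right w ∈ A :=
    fun {ι} _ => IsDelta11.subst (P := fun (_ : Unit) x => x ∈ A) hA (Primrec.const ())
      RecMap.id.right
  have hle : ∀ {ι : Type} [Primcodable ι], IsDelta11 fun (_ : ι) w => TuringLE (left w) (right w) :=
    fun {ι} _ => ((isDelta11_turingLE (ι := ι)).subst (ι := ι) Primrec.id
      (RecMap.id.right.join RecMap.id.left)).congr fun i w => by simp
  constructor
  · have h1 : IsSigma11 fun (p : Unit × Code) x =>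
        ∃ y, Computes p.2 x y ∧ (y ∈ A ∨ ¬ TuringLE x y) :=
      ((isDelta11_computes.subst (ι := Unit × Code) Primrec.snd RecMap.id).1.and
        (hsub.or hle.not).1).exists_real.congr fun p x => by simp
    have h2 : IsSigma11 fun (p : Unit × Code) x => ∃ n, ∀ m, ¬ OracleValue p.2 n m x :=
      (isDelta11_oracleValue.not.1.reindex (u := fun p : ((Unit × Code) × ℕ) × ℕ =>
        ((p.1.1.2, p.1.2), p.2)) (((Primrec.snd.comp (Primrec.fst.comp Primrec.fst)).pair
          (Primrec.snd.comp Primrec.fst)).pair Primrec.snd)).all.ex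
    refine (h2.or h1).all.congr fun _ x => ?_
    constructor
    · intro hx c
      by_cases htot : ∀ n, ∃ m, OracleValue c n m x
      · choose y hy using htot
        right
        refine ⟨y, hy, ?_⟩
        by_cases hyx : TuringLE x y
        · exact Or.inl (hx y ⟨hyx, turingLE_iff_exists_computes.2 ⟨c, hy⟩⟩)
        · exact Or.inr hyx
      · left; push Not at htot; exact htot
    · intro H y hy
      obtain ⟨c, hc⟩ := turingLE_iff_exists_computes.1 hy.2
      obtain ⟨n, hn⟩ | ⟨y', hc', hy'⟩ := H c
      · exact absurd (hc n) (hn _)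
      · obtain rfl := hc.unique hc'
        exact hy'.resolve_right (not_not.2 hy.1)
  · have h1 := ((hle (ι := Unit)).and isDelta11_turingLE).and hsub.not
    refine h1.1.exists_real.congr fun _ x => ?_
    simp only [Baire.turingCore, Set.mem_ofPred_eq, not_forall, left_join, right_join, TuringEq,
      exists_prop]

/-! ### Determined Turing closed sets -/

/-- The successive positions of the play in which the moves at stages of parity `b` are made by
the strategy `σ` and the opponent plays the successive values of `y`. Player I is the case
`b = false`. -/
def position (b : Bool) (σ : List ℕ → ℕ) (y : Baire) : ℕ → List ℕ
  | 0 => []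
  | t + 1 => position b σ y t ++
      [bif t.bodd == b then σ (position b σ y t) else y t.div2]

/-- The play with positions `position b σ y`. -/
def play (b : Bool) (σ : List ℕ → ℕ) (y : Baire) : Baire := fun t =>
  bif t.bodd == b then σ (position b σ y t) else y t.div2

variable {b : Bool} {σ : List ℕ → ℕ} {x y : Baire} {A : Set Baire}

theorem initSeg_play (b : Bool) (σ : List ℕ → ℕ) (y : Baire) (t : ℕ) :
    initSeg (play b σ y) t = position b σ y t := by
  induction t with
  | zero => rfl
  | succ t ih => rw [initSeg_succ, ih]; rfl

theorem followsI_play (σ : List ℕ → ℕ) (y : Baire) : FollowsI σ (play false σ y) := fun n => by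
  rw [initSeg_play]; simp [play]

theorem followsII_play (σ : List ℕ → ℕ) (y : Baire) : FollowsII σ (play true σ y) := fun n => by
  rw [initSeg_play]; simp [play]

theorem right_play (σ : List ℕ → ℕ) (y : Baire) : right (play false σ y) = y := by
  funext n; simp [right, play]

theorem left_play (σ : List ℕ → ℕ) (y : Baire) : left (play true σ y) = y := by
  funext n; simp [left, play]

theorem turingLE_play
    (hσ : TuringLE (fun n => σ (Denumerable.ofNat (List ℕ) n)) x) (hy : TuringLE y x) :
    TuringLE (play b σ y) x := by
  have hmove : TuringLE (fun p => bif p.unpair.1.bodd == b then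
      σ (Denumerable.ofNat (List ℕ) p.unpair.2) else y p.unpair.1.div2) x := by
    have hp : Primrec₂ fun p v : ℕ =>
        bif p.unpair.1.bodd == b then v.unpair.1 else v.unpair.2 :=
      Primrec.cond ((Primrec.dom_finite (· == b)).comp (Primrec.nat_bodd.comp
        (Primrec.fst.comp (Primrec.unpair.comp Primrec.fst))))
        (Primrec.fst.comp (Primrec.unpair.comp Primrec.snd))
        (Primrec.snd.comp (Primrec.unpair.comp Primrec.snd))
    have h1 := (hσ.comp (.of_primrec (Primrec.snd.comp Primrec.unpair))).pair
      (hy.comp (.of_primrec (Primrec.nat_div2.comp (Primrec.fst.comp Primrec.unpair))))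
    convert TuringLE.map₂ hp (.of_primrec (x := x) Primrec.id) h1 using 2 with p
    simp
  have hconcat : Primrec₂ fun p v : ℕ =>
      Encodable.encode (Denumerable.ofNat (List ℕ) p.unpair.2 ++ [v]) :=
    Primrec.encode.comp (Primrec.list_concat.comp ((Primrec.ofNat _).comp
      (Primrec.snd.comp (Primrec.unpair.comp Primrec.fst))) Primrec.snd)
  have hpos : TuringLE (fun t => Encodable.encode (position b σ y t)) x := by
    convert TuringLE.nat_rec (Encodable.encode ([] : List ℕ))
      (TuringLE.map₂ hconcat (.of_primrec (x := x) Primrec.id) hmove) using 2 with t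
    induction t with
    | zero => rfl
    | succ t ih => simp only [position, ← ih]; simp
  convert hmove.comp ((TuringLE.of_primrec (x := x) Primrec.id).pair hpos) using 2 with t
  simp [play]

/-- If the game of a Turing closed set is determined, the set and its complement are not both
cofinal: against a real that computes the winning strategy, the play is equivalent to this real. -/
theorem not_turingCofinal_of_determined (hA : TuringClosed A) (hdet : Determined A)
    (h : TuringCofinal A) (h' : TuringCofinal Aᶜ) : False := by
  rcases hdet with ⟨σ, hσ⟩ | ⟨σ, hσ⟩
  · obtain ⟨y, hy, hle⟩ := h' fun n => σ (Denumerable.ofNat (List ℕ) n)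
    refine hy (hA _ _ ⟨turingLE_play hle (.refl y), ?_⟩ (hσ _ (followsI_play σ y)))
    simpa only [right_play] using TuringLE.right (play false σ y)
  · obtain ⟨y, hy, hle⟩ := h fun n => σ (Denumerable.ofNat (List ℕ) n)
    refine hσ _ (followsII_play σ y) (hA _ _ ⟨?_, turingLE_play hle (.refl y)⟩ hy)
    simpa only [left_play] using TuringLE.left (play true σ y)

/-- Under Turing determinacy for `Δ¹₁` sets, disjoint `Σ¹₁` sets, one of which is Turing closed,
are not both cofinal. -/
theorem Delta11TuringDeterminacy.not_disjoint (hdet : Delta11TuringDeterminacy)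
    {A B : Set Baire} (hA : IsSigma11 fun (_ : Unit) x => x ∈ A)
    (hB : IsSigma11 fun (_ : Unit) x => x ∈ B) (hclosed : TuringClosed A)
    (hcA : TuringCofinal A) (hcB : TuringCofinal B) : ¬ Disjoint A B := by
  intro hAB
  obtain ⟨C, hC, hAC, hBC⟩ := hA.exists_separation hB hAB
  refine not_turingCofinal_of_determined (turingClosed_turingCore C)
    (hdet _ hC.turingCore (turingClosed_turingCore C)) (fun x => ?_) (fun x => ?_)
  · obtain ⟨y, hy, hle⟩ := hcA x
    exact ⟨y, hclosed.subset_turingCore hAC hy, hle⟩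
  · obtain ⟨y, hy, hle⟩ := hcB x
    exact ⟨y, fun h => Set.disjoint_left.1 hBC hy (turingCore_subset C h), hle⟩

/-! ### Hyperarithmetic selection of counterexamples -/

theorem HypLE.refl (d : Baire) : HypLE d d := by
  have h : IsDelta11 fun (p : ℕ × ℕ) x => x p.1 = p.2 := by
    have h1 : RecFun fun (p : ℕ × ℕ) x => decide (x p.1 = p.2) :=
      RecFun.comp₂ (p := fun (p : ℕ × ℕ) (v : ℕ) => decide (v = p.2))
        (primrecPred_iff_primrec_decide.1 (Primrec.eq.comp Primrec.snd
          (Primrec.snd.comp Primrec.fst))) (RecFun.eval Primrec.fst)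
    exact (IsDelta11.of_recFun h1).congr fun p x => by simp
  exact ⟨⟨_, h.1, fun _ => Iff.rfl⟩, ⟨_, h.2, fun _ => Iff.rfl⟩⟩

/-- A uniform coding of the reals hyperarithmetic in a given real by machine indices: the graphs of
the coded functions are uniformly `Π¹₁`, obtained by uniformizing the universal `Π¹₁` relation. -/
theorem exists_hyp_coding : ∃ V : (Code × ℕ) × ℕ → Baire → Prop, IsPi11 V ∧
    (∀ q m m' d, V (q, m) d → V (q, m') d → m = m') ∧
    ∀ x d, HypLE x d → ∃ c, ∀ n, V ((c, n), x n) d := by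
  have hU : IsPi11 fun (p : (Code × ℕ) × ℕ) d => ¬ UnivSigma (p.1.1, (p.1.2, p.2)) d :=
    (isSigma11_univSigma.reindex (u := fun p : (Code × ℕ) × ℕ => (p.1.1, (p.1.2, p.2)))
      ((Primrec.fst.comp Primrec.fst).pair ((Primrec.snd.comp Primrec.fst).pair
        Primrec.snd))).congr fun _ _ => not_not
  obtain ⟨V, hV, hsub, huniq, hex⟩ := hU.exists_uniformization
  refine ⟨V, hV, huniq, ?_⟩
  rintro x d ⟨-, Q, hQ, hxQ⟩
  obtain ⟨c, hc⟩ := exists_univSigma_index hQ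
  have hgraph : ∀ n m, ¬ UnivSigma (c, (n, m)) d ↔ x n = m := fun n m => by
    rw [← hc, not_not, ← hxQ]
  refine ⟨c, fun n => ?_⟩
  obtain ⟨m, hm⟩ := hex (c, n) d ⟨x n, (hgraph n _).2 rfl⟩
  rwa [(hgraph n m).1 (hsub _ _ hm)]

/-- If every hyp-Turing cone meets the complement of some `S k`, then for some `k` there is a
cofinal `Σ¹₁` set disjoint from `S k`: a pair of a machine index and a number `k` is chosen for
every real `d` in a `Δ¹₁` way, such that the index codes a real `z` with `d ⊕ z ∉ S k`, and
the set consists of the joins `d ⊕ z` with the given `k`. -/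
theorem exists_cofinal_disjoint {S : ℕ → Set Baire} (hS : IsSigma11Seq S)
    (hclosed : ∀ k, TuringClosed (S k)) (hno : ∀ d, ¬ hypTuringCone d ⊆ ⋂ k, S k) :
    ∃ (k : ℕ) (B : Set Baire), IsSigma11 (fun (_ : Unit) x => x ∈ B) ∧ TuringCofinal B ∧
      Disjoint (S k) B := by
  obtain ⟨V, hV, hVuniq, hVhyp⟩ := exists_hyp_coding
  -- `Agree c w`: the odd part of `w` has no disagreement with the function coded by `c`.
  let Agree : Code → Baire → Prop := fun c w => ∀ n m, ¬ V ((c, n), m) (left w) ∨ right w n = m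
  have hAgree : IsSigma11 Agree := by
    have h1 : RecFun fun (p : (Code × ℕ) × ℕ) w => decide (right w p.1.2 = p.2) := by
      refine RecFun.comp₂ (p := fun (p : (Code × ℕ) × ℕ) (v : ℕ) => decide (v = p.2)) ?_
        (RecFun.eval_map RecMap.id.right (Primrec.snd.comp Primrec.fst))
      exact primrecPred_iff_primrec_decide.1 (Primrec.eq.comp Primrec.snd
        (Primrec.snd.comp Primrec.fst))
    refine ((IsSigma11.subst hV Primrec.id RecMap.id.left).or
      (IsSigma11.of_recFun h1)).all.all.congr fun c w => ?_
    simp only [Agree, decide_eq_true_eq, id]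
  -- The pair `(c, k)` is admissible at `d` if `c` codes a total function `z` with `d ⊕ z ∉ S k`.
  -- Quantifying over all `z` that agree with the code keeps this condition `Π¹₁`.
  have hW : IsPi11 fun (p : Unit × (Code × ℕ)) d =>
      (∀ n, ∃ m, V ((p.2.1, n), m) d) ∧ ∀ z, Agree p.2.1 (join d z) → join d z ∉ S p.2.2 := by
    have h1 : IsSigma11 fun (p : Unit × (Code × ℕ)) d => ∃ n, ∀ m, ¬ V ((p.2.1, n), m) d :=
      (IsSigma11.reindex (u := fun p : ((Unit × (Code × ℕ)) × ℕ) × ℕ =>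
        ((p.1.1.2.1, p.1.2), p.2)) hV (((Primrec.fst.comp (Primrec.snd.comp
          (Primrec.fst.comp Primrec.fst))).pair (Primrec.snd.comp Primrec.fst)).pair
            Primrec.snd)).all.ex
    have h2 := ((hAgree.reindex (ι := Unit × (Code × ℕ)) (Primrec.fst.comp Primrec.snd)).and
      (IsSigma11.reindex hS (Primrec.snd.comp Primrec.snd))).exists_real
    refine (h1.or h2).congr fun p d => ?_
    simp only [not_and_or, not_forall, not_exists, not_not, exists_prop]
  obtain ⟨W, hWpi, hWsub, hWuniq, hWex⟩ := hW.exists_uniformization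
  have hWtotal : ∀ d, ∃ q, W ((), q) d := by
    intro d
    refine hWex () d ?_
    obtain ⟨x, ⟨hdx, hxd⟩, hx⟩ := Set.not_subset.1 (hno d)
    obtain ⟨k, hk⟩ := not_forall.1 (fun h => hx (Set.mem_iInter.2 h))
    obtain ⟨c, hc⟩ := hVhyp x d hxd
    refine ⟨(c, k), fun n => ⟨_, hc n⟩, fun z hz => ?_⟩
    -- The coded real computes `d`, so that joining `d` to it does not change its Turing degree.
    obtain rfl : z = x := funext fun n => by
      simpa [hc n] using hz n (x n)
    have hright := TuringLE.right (join d z)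
    rw [right_join] at hright
    exact fun h => hk (hclosed k _ _ ⟨hdx.join (.refl z), hright⟩ h)
  let B : ℕ → Set Baire := fun k =>
    {w | ∃ c, (∀ q, q = (c, k) ∨ ¬ W ((), q) (left w)) ∧ Agree c w}
  have hB : ∀ k, IsSigma11 fun (_ : Unit) w => w ∈ B k := by
    intro k
    have h1 := IsSigma11.of_primrecPred (p := fun p : (Unit × Code) × (Code × ℕ) =>
      p.2 = (p.1.2, k)) (Primrec.eq.comp Primrec.snd
        ((Primrec.snd.comp Primrec.fst).pair (Primrec.const k)))
    have h2 := IsSigma11.subst (u := fun p : (Unit × Code) × (Code × ℕ) => ((), p.2)) hWpi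
      ((Primrec.const ()).pair Primrec.snd) RecMap.id.left
    exact ((h1.or h2).all.and (hAgree.reindex Primrec.snd)).ex
  have hdisj : ∀ k, Disjoint (S k) (B k) := by
    refine fun k => Set.disjoint_right.2 fun w ⟨c, hq, hc⟩ hw => ?_
    obtain ⟨q, hWq⟩ := hWtotal (left w)
    obtain rfl := (hq q).resolve_right (not_not.2 hWq)
    rw [← join_left_right w] at hc hw
    exact (hWsub _ _ hWq).2 (right w) hc hw
  by_contra hcof
  push Not at hcof
  have hbound : ∀ k, ∃ x, ∀ w ∈ B k, ¬ TuringLE x w := fun k => by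
    by_contra h
    push Not at h
    exact hcof k (B k) (hB k) h (hdisj k)
  choose x hx using hbound
  obtain ⟨d, hd⟩ := exists_column x
  obtain ⟨⟨c, k⟩, hq⟩ := hWtotal d
  choose z hz using (hWsub _ _ hq).1
  have hmem : join d z ∈ B k := by
    refine ⟨c, fun q => ?_, fun n m => ?_⟩
    · rw [left_join, or_iff_not_imp_right, not_not]
      exact fun h => hWuniq _ _ _ _ h hq
    · rw [left_join, right_join, or_iff_not_imp_left, not_not]
      exact fun h => hVuniq _ _ _ _ (hz n) h
  refine hx k _ hmem (TuringLE.trans (y := d) ?_ ?_)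
  · simpa only [hd] using TuringLE.column d k
  · simpa only [left_join] using TuringLE.left (join d z)

end Baire

theorem mainTheorem6 (hdet : Baire.Delta11TuringDeterminacy)
    (S : ℕ → Set Baire) (hS : Baire.IsSigma11Seq S)
    (hclosed : ∀ k, Baire.TuringClosed (S k))
    (hcof : ∀ k, Baire.TuringCofinal (S k)) :
    (⋂ k, S k).Nonempty ∧ ∃ d₀ : Baire, Baire.hypTuringCone d₀ ⊆ ⋂ k, S k := by
  have hcone : ∃ d₀ : Baire, Baire.hypTuringCone d₀ ⊆ ⋂ k, S k := by
    by_contra hno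
    push Not at hno
    obtain ⟨k, B, hB, hcB, hdisj⟩ := Baire.exists_cofinal_disjoint hS hclosed hno
    have hSk : Baire.IsSigma11 fun (_ : Unit) x => x ∈ S k :=
      Baire.IsSigma11.reindex hS (Primrec.const k)
    exact hdet.not_disjoint hSk hB (hclosed k) (hcof k) hcB hdisj
  obtain ⟨d, hd⟩ := hcone
  exact ⟨⟨d, hd ⟨.refl d, .refl d⟩⟩, d, hd⟩
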